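/- Let $k$ be an algebraically closed field and let $X$ be a non-empty reduced separated $k$-scheme locally of finite type. Points of $X$ are $k$-points. A strict birational group law on $X$ is a reduced locally closed subscheme $W\subset X\times X\times X$ such that: (i) for all $1\le i<j\le 3$ the projection $\mathrm{pr}_{i,j}\colon W\to X\times X$ is an open immersion with dense image $U_{i,j}$; so $W$ is the graph of a morphism $f_{1,2}\colon U_{1,2}\to X$, written $(a,b)\mapsto ab$; (ii) for every $a\in X(k)$ and all $i<j$, the inverse images of $U_{i,j}$ under $(a,\mathrm{id}_X)$ and $(\mathrm{id}_X,a)\colon X\to X\times X$ are dense in $X$; (iii) $a(bc)=(ab)c$ for all $a,b,c\in X(k)$ such that $(a,b)$, $(b,c)$, $(ab,c)$ and $(a,bc)$ lie in $U_{1,2}$. Let $W$ be such a law. Let $\mathcal R$ be the group, under composition, of birational self-maps of $X$ over $k$: classes of $k$-isomorphisms between dense open subschemes, two being equivalent if they agree on a dense open subscheme. For $g\in\mathcal R$ let $\mathrm{Dom}(g)$ be the largest open subset of $X$ on which $g$ is a morphism. For $a\in X(k)$ let $\phi(a)\in\mathcal R$ be the class of the isomorphism $x\mapsto ax$ from $(a,\mathrm{id}_X)^{-1}(U_{1,2})$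 onto $(a,\mathrm{id}_X)^{-1}(U_{1,3})$. Let $G\subset\mathcal R$ be the subgroup generated by $\phi(X(k))$, and for $g\in G$ put $\phi_g\colon X(k)\to G$, $\phi_g(a)=g\,\phi(a)$. Then: 1. The charts $\phi_g$ are compatible: for $g_1,g_2\in G$ there are a dense open $U\subset X$ and a $k$-morphism $h\colon U\to X$ such that, for $a,b\in X(k)$, $\phi_{g_1}(a)=\phi_{g_2}(b)$ if and only if $b\in U$ and $a=h(b)$. There are a reduced $k$-group scheme $\mathcal G$, locally of finite type, a group isomorphism $G\cong\mathcal G(k)$, and for every $g\in G$ a $k$-morphism $X\to\mathcal G$ which induces $\phi_g$ on $k$-points; these morphisms are open immersions with dense image, and their images cover $\mathcal G$. 2. $\mathcal G$ is separated, and its group law extends that of $X$: with $\Phi\colon X\to\mathcal G$ the morphism inducing $\phi=\phi_1$, and $p_1,p_2,p_3\colon W\to X$ the coordinates, $(\Phi\circ p_1)\cdot(\Phi\circ p_2)=\Phi\circ p_3$. In particular $\phi(a)\phi(b)=\phi(ab)$ for all $k$-points $(a,b)$ of $U_{1,2}$. 3. The map $X(k)\times X(k)\to G$, $(a,b)\mapsto\phi(a)\phi(b)^{-1}$,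 is surjective, and its fibre over $g\in G$ is $\{(a,b): b\in\mathrm{Dom}(g),\ a=g(b)\}$. 4. Every $g\in G$ induces an isomorphism from $\mathrm{Dom}(g)$ to $\mathrm{Dom}(g^{-1})$, with inverse induced by $g^{-1}$. 5. If $X$ is of finite type over $k$, then so is $\mathcal G$. -/

import Mathlib

open CategoryTheory MonoidalCategory CartesianMonoidalCategory AlgebraicGeometry
open scoped MonObj

universe u

namespace BirationalGroupLaw

noncomputable section

/-! ### Birational self-maps -/

/-- For a partial map `f` from `X` to `Y` and `T`-valued points `b` of `X` and `a` of `Y`: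
the point `b` lies in the domain of `f`, and `f b = a`. -/
def TakesValue {X Y T : Scheme.{u}} (f : X.PartialMap Y) (b : T ⟶ X) (a : T ⟶ Y) : Prop :=
  ∃ t : T ⟶ f.domain.toScheme, t ≫ f.domain.ι = b ∧ t ≫ f.hom = a

theorem TakesValue.precomp {X Y T T' : Scheme.{u}} {f : X.PartialMap Y} {b : T ⟶ X} {a : T ⟶ Y}
    (h : TakesValue f b a) (s : T' ⟶ T) : TakesValue f (s ≫ b) (s ≫ a) := by
  obtain ⟨t, rfl, rfl⟩ := h
  exact ⟨s ≫ t, by simp, by simp⟩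

theorem TakesValue.unique {X Y T : Scheme.{u}} {f : X.PartialMap Y} {b : T ⟶ X} {a a' : T ⟶ Y}
    (h : TakesValue f b a) (h' : TakesValue f b a') : a = a' := by
  obtain ⟨t, ht, rfl⟩ := h
  obtain ⟨t', ht', rfl⟩ := h'
  rw [← cancel_mono f.domain.ι |>.mp (ht.trans ht'.symm)]

theorem takesValue_iso {X Y T : Scheme.{u}} {f : X.PartialIso Y} {b : T ⟶ X} {a : T ⟶ Y} :
    TakesValue f.toPartialMap b a ↔
      ∃ t : T ⟶ f.source.toScheme, t ≫ f.source.ι = b ∧ t ≫ f.iso.hom ≫ f.target.ι = a :=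
  Iff.rfl

theorem TakesValue.symm {X Y T : Scheme.{u}} {f : X.PartialIso Y} {b : T ⟶ X} {a : T ⟶ Y}
    (h : TakesValue f.toPartialMap b a) : TakesValue f.symm.toPartialMap a b := by
  obtain ⟨t, rfl, rfl⟩ := takesValue_iso.mp h
  have e : (t ≫ f.iso.hom) ≫ f.iso.inv ≫ f.source.ι = t ≫ f.source.ι := by simp
  exact takesValue_iso.mpr ⟨t ≫ f.iso.hom, Category.assoc _ _ _, e⟩

theorem range_subset_of_factors {X T : Scheme.{u}} {U : X.Opens} {b : T ⟶ X}
    (t : T ⟶ U.toScheme) (h : t ≫ U.ι = b) : Set.range b ⊆ U := by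
  subst h
  rintro _ ⟨x, rfl⟩
  rw [Scheme.Hom.comp_apply]
  exact (t x).2

theorem takesValue_restrictSource {X Y T : Scheme.{u}} {f : X.PartialIso Y} {U : X.Opens}
    (hU : Dense (U : Set X)) (hU' : U ≤ f.source) {a : T ⟶ Y} (t : T ⟶ U.toScheme)
    (h : TakesValue f.toPartialMap (t ≫ U.ι) a) :
    TakesValue (f.restrictSource U hU hU').toPartialMap (t ≫ U.ι) a := by
  obtain ⟨s, hs, rfl⟩ := takesValue_iso.mp h
  have hs' : s = t ≫ X.homOfLE hU' := by
    rw [← cancel_mono f.source.ι, hs]; simp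
  refine takesValue_iso.mpr ⟨t, rfl, ?_⟩
  subst hs'
  have e : (Scheme.Opens.isoOfLE hU').inv ≫ (f.source.ι ⁻¹ᵁ U).ι = X.homOfLE hU' := by
    rw [← cancel_mono f.source.ι]; simp
  simp [Scheme.PartialIso.restrictSource, ← e]

theorem TakesValue.trans' {X Y Z T : Scheme.{u}} {f : X.PartialIso Y} {g : Y.PartialIso Z}
    (e : f.target = g.source) {b : T ⟶ X} {a : T ⟶ Y} {c : T ⟶ Z}
    (h : TakesValue f.toPartialMap b a) (h' : TakesValue g.toPartialMap a c) :
    TakesValue (f.trans' g e).toPartialMap b c := by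
  obtain ⟨t, rfl, ht⟩ := takesValue_iso.mp h
  obtain ⟨s, hs, rfl⟩ := takesValue_iso.mp h'
  have e' : t ≫ f.iso.hom ≫ (Y.isoOfEq e).hom = s := by
    rw [← cancel_mono g.source.ι, hs, ← ht]; simp
  refine takesValue_iso.mpr ⟨t, rfl, ?_⟩
  subst e'
  simp [Scheme.PartialIso.trans']

theorem TakesValue.trans {X Y Z T : Scheme.{u}} {f : X.PartialIso Y} {g : Y.PartialIso Z}
    {b : T ⟶ X} {a : T ⟶ Y} {c : T ⟶ Z} (h : TakesValue f.toPartialMap b a)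
    (h' : TakesValue g.toPartialMap a c) : TakesValue (f.trans g).toPartialMap b c := by
  obtain ⟨t, rfl, ht⟩ := takesValue_iso.mp h
  obtain ⟨s, hs, rfl⟩ := takesValue_iso.mp h'
  have hd := f.dense_target.inter_of_isOpen_right g.dense_source g.source.2
  have hr : Set.range a ⊆ Set.range (f.target ⊓ g.source).ι := by
    rw [Scheme.Opens.range_ι]
    exact Set.subset_inter (range_subset_of_factors (t ≫ f.iso.hom) (by simpa using ht))
      (range_subset_of_factors s hs)
  obtain ⟨v, rfl⟩ : ∃ v, v ≫ (f.target ⊓ g.source).ι = a :=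
    ⟨IsOpenImmersion.lift _ _ hr, IsOpenImmersion.lift_fac _ _ _⟩
  exact TakesValue.trans' rfl
    (takesValue_restrictSource (f := f.symm) hd inf_le_left v h.symm).symm
    (takesValue_restrictSource hd inf_le_right v h')

theorem equiv_iff_takesValue {X Y : Scheme.{u}} {f g : X.PartialMap Y} :
    f.equiv g ↔ ∃ (T : Scheme.{u}) (t : T ⟶ X) (t' : T ⟶ Y), IsOpenImmersion t ∧ IsDominant t ∧
      TakesValue f t t' ∧ TakesValue g t t' := by
  constructor
  · rintro ⟨W, hW, hf, hg, h⟩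
    refine ⟨W, W.ι, X.homOfLE hf ≫ f.hom, inferInstance, AlgebraicGeometry.Opens.isDominant_ι hW,
      ⟨X.homOfLE hf, by simp, rfl⟩, ⟨X.homOfLE hg, by simp, ?_⟩⟩
    exact h.symm
  · rintro ⟨T, t, t', ho, hd, ⟨u, hu, rfl⟩, ⟨v, hv, hv'⟩⟩
    have hf : t.opensRange ≤ f.domain := range_subset_of_factors u hu
    have hg : t.opensRange ≤ g.domain := range_subset_of_factors v hv
    refine ⟨t.opensRange, t.denseRange, hf, hg, ?_⟩
    change X.homOfLE hf ≫ f.hom = X.homOfLE hg ≫ g.hom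
    rw [← cancel_epi t.isoOpensRange.hom]
    have e₁ : t.isoOpensRange.hom ≫ X.homOfLE hf = u := by
      rw [← cancel_mono f.domain.ι]; simp [hu]
    have e₂ : t.isoOpensRange.hom ≫ X.homOfLE hg = v := by
      rw [← cancel_mono g.domain.ι]; simp [hv]
    have : (t.isoOpensRange.hom ≫ X.homOfLE hf) ≫ f.hom =
      (t.isoOpensRange.hom ≫ X.homOfLE hg) ≫ g.hom := by rw [e₁, e₂, hv']
    simpa using this

/-- Isomorphisms over `S` between dense open subschemes of `X`. -/
def PartialAut {S : Scheme.{u}} (X : Over S) : Type u :=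
  {f : X.left.PartialIso X.left // f.IsOver X.hom X.hom}

/-- Two elements `(U, f, V)`, `(U', f', V')` are equivalent if `f` and `f'` agree on a dense open
subscheme. If `X` is reduced and separated, this says that `f` and `f'` agree on `U ∩ U'`. -/
instance PartialAut.setoid {S : Scheme.{u}} (X : Over S) : Setoid (PartialAut X) where
  r f g := f.1.toPartialMap.equiv g.1.toPartialMap
  iseqv :=
    { refl := fun _ => Scheme.PartialMap.equiv.refl _
      symm := fun h => Scheme.PartialMap.equiv.symm h
      trans := fun h h' => Scheme.PartialMap.equiv.trans h h' }

theorem equiv_of_takesValue {X Y : Scheme.{u}} {f g : X.PartialIso Y}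
    (h : ∀ (T : Scheme.{u}) (b : T ⟶ X) (a : T ⟶ Y), TakesValue f.toPartialMap b a →
      TakesValue g.toPartialMap b a) : f.toPartialMap.equiv g.toPartialMap := by
  have h₀ : TakesValue f.toPartialMap f.source.ι (f.iso.hom ≫ f.target.ι) :=
    takesValue_iso.mpr ⟨𝟙 _, by simp, by simp⟩
  exact equiv_iff_takesValue.mpr ⟨_, _, _, inferInstance,
    AlgebraicGeometry.Opens.isDominant_ι f.dense_source, h₀, h _ _ _ h₀⟩

theorem isOpenImmersion_of_takesValue {X Y T : Scheme.{u}} {f : X.PartialIso Y}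
    {b : T ⟶ X} {a : T ⟶ Y} (h : TakesValue f.toPartialMap b a) [IsOpenImmersion b] :
    IsOpenImmersion a := by
  obtain ⟨t, rfl, rfl⟩ := takesValue_iso.mp h
  have : IsOpenImmersion t := .of_comp t f.source.ι
  infer_instance

theorem isDominant_of_takesValue {X Y T : Scheme.{u}} {f : X.PartialIso Y}
    {b : T ⟶ X} {a : T ⟶ Y} (h : TakesValue f.toPartialMap b a) [IsDominant b] :
    IsDominant a := by
  obtain ⟨t, rfl, rfl⟩ := takesValue_iso.mp h
  have : IsDominant f.target.ι := AlgebraicGeometry.Opens.isDominant_ι f.dense_target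
  have : IsDominant t := by
    refine ⟨?_⟩
    have hd := (IsDominant.denseRange (f := t ≫ f.source.ι)).preimage
      f.source.ι.isOpenEmbedding.isOpenMap
    rwa [Scheme.Hom.comp_base, TopCat.coe_comp, Set.range_comp,
      Set.preimage_image_eq _ f.source.ι.injective] at hd
  infer_instance

theorem equiv_symm {X Y : Scheme.{u}} {f g : X.PartialIso Y}
    (h : f.toPartialMap.equiv g.toPartialMap) :
    f.symm.toPartialMap.equiv g.symm.toPartialMap := by
  obtain ⟨T, t, t', _, _, hf, hg⟩ := equiv_iff_takesValue.mp h
  exact equiv_iff_takesValue.mpr ⟨T, t', t, isOpenImmersion_of_takesValue hf,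
    isDominant_of_takesValue hf, hf.symm, hg.symm⟩

theorem equiv_trans {X Y Z : Scheme.{u}} {f f' : X.PartialIso Y} {g g' : Y.PartialIso Z}
    (h : f.toPartialMap.equiv f'.toPartialMap) (h' : g.toPartialMap.equiv g'.toPartialMap) :
    (f.trans g).toPartialMap.equiv (f'.trans g').toPartialMap := by
  obtain ⟨T, t, t', _, _, hf, hf'⟩ := equiv_iff_takesValue.mp h
  obtain ⟨U, u, u', _, _, hg, hg'⟩ := equiv_iff_takesValue.mp h'
  have := isOpenImmersion_of_takesValue hf
  have : IsDominant (Limits.pullback.fst t' u) := by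
    refine ⟨?_⟩
    rw [DenseRange, Scheme.Pullback.range_fst]
    exact u.denseRange.preimage t'.isOpenEmbedding.isOpenMap
  have e := Limits.pullback.condition (f := t') (g := u)
  refine equiv_iff_takesValue.mpr ⟨_, Limits.pullback.fst t' u ≫ t, Limits.pullback.snd t' u ≫ u',
    inferInstance, inferInstance, (hf.precomp _).trans ?_, (hf'.precomp _).trans ?_⟩
  · rw [e]
    exact hg.precomp _
  · rw [e]
    exact hg'.precomp _

theorem takesValue_of_restrictSource {X Y T : Scheme.{u}} {f : X.PartialIso Y} {U : X.Opens}
    {hU : Dense (U : Set X)} {hU' : U ≤ f.source} {b : T ⟶ X} {a : T ⟶ Y}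
    (h : TakesValue (f.restrictSource U hU hU').toPartialMap b a) :
    TakesValue f.toPartialMap b a := by
  obtain ⟨t, ht⟩ : ∃ t : T ⟶ U.toScheme, t ≫ U.ι = b := by
    obtain ⟨t, ht, _⟩ := takesValue_iso.mp h
    exact ⟨t, ht⟩
  have h₁ : TakesValue f.toPartialMap (t ≫ U.ι)
      (t ≫ X.homOfLE hU' ≫ f.iso.hom ≫ f.target.ι) :=
    takesValue_iso.mpr ⟨t ≫ X.homOfLE hU', (Category.assoc _ _ _).trans
      (congrArg (t ≫ ·) (X.homOfLE_ι hU')), Category.assoc _ _ _⟩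
  have h₂ := takesValue_restrictSource hU hU' _ h₁
  rw [ht] at h₁ h₂
  rwa [h.unique h₂]

theorem takesValue_trans_iff {X Y Z T : Scheme.{u}} {f : X.PartialIso Y} {g : Y.PartialIso Z}
    {b : T ⟶ X} {c : T ⟶ Z} : TakesValue (f.trans g).toPartialMap b c ↔
      ∃ a, TakesValue f.toPartialMap b a ∧ TakesValue g.toPartialMap a c := by
  refine ⟨fun h => ?_, fun ⟨a, h, h'⟩ => h.trans h'⟩
  have hd := f.dense_target.inter_of_isOpen_right g.dense_source g.source.2
  obtain ⟨t, ht₁, ht₂⟩ := takesValue_iso.mp h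
  have e : (f.trans g).iso = (f.restrictTarget _ hd inf_le_left).iso ≪≫
    Y.isoOfEq rfl ≪≫ (g.restrictSource _ hd inf_le_right).iso := rfl
  let v : T ⟶ (f.target ⊓ g.source).toScheme :=
    t ≫ (f.restrictTarget _ hd inf_le_left).iso.hom
  refine ⟨v ≫ (f.target ⊓ g.source).ι, ?_, ?_⟩
  · have h₁ : TakesValue (f.restrictTarget _ hd inf_le_left).toPartialMap b
        (v ≫ (f.target ⊓ g.source).ι) :=
      takesValue_iso.mpr ⟨t, ht₁, (Category.assoc _ _ _).symm⟩
    exact (takesValue_of_restrictSource (f := f.symm) h₁.symm).symm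
  · refine takesValue_of_restrictSource (hU := hd) (hU' := inf_le_right)
      (takesValue_iso.mpr ⟨v, rfl, ?_⟩)
    rw [← ht₂, e]
    simp only [Iso.trans_hom, Scheme.isoOfEq_rfl, v]
    exact (Category.assoc _ _ _).trans (congrArg (t ≫ ·) (Category.assoc _ _ _).symm)

/-- The set of birational maps over `S` from `X` to itself. -/
def Bir {S : Scheme.{u}} (X : Over S) : Type u :=
  Quotient (PartialAut.setoid X)

namespace Bir

variable {S : Scheme.{u}} {X : Over S}

/-- The birational map represented by an isomorphism between dense open subschemes. -/
def mk (f : PartialAut X) : Bir X := Quotient.mk _ f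

/-- The product of `g` and `f` is the composite `x ↦ g (f x)`. -/
instance : Mul (Bir X) where
  mul := Quotient.map₂ (fun g f => ⟨f.1.trans g.1, f.2.trans g.2⟩)
    fun _ _ h _ _ h' => equiv_trans h' h

instance : One (Bir X) where
  one := mk ⟨Scheme.PartialIso.refl X.left, Category.id_comp _⟩

instance : Inv (Bir X) where
  inv := Quotient.map (fun f => ⟨f.1.symm, f.2.symm⟩) fun _ _ h => equiv_symm h

theorem takesValue_refl {X T : Scheme.{u}} {b a : T ⟶ X} :
    TakesValue (Scheme.PartialIso.refl X).toPartialMap b a ↔ b = a := by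
  have h : TakesValue (Scheme.PartialIso.refl X).toPartialMap b b := by
      have ht : (b ≫ X.topIso.inv) ≫ (⊤ : X.Opens).ι = b := by simp
      exact takesValue_iso.mpr ⟨_, ht, (congrArg ((b ≫ X.topIso.inv) ≫ ·)
        (Category.id_comp (⊤ : X.Opens).ι)).trans ht⟩
  exact ⟨h.unique, fun e => e ▸ h⟩

instance : Group (Bir X) where
  mul_assoc := by
    rintro ⟨f⟩ ⟨g⟩ ⟨h⟩
    refine Quotient.sound (equiv_of_takesValue fun T b a H => ?_)
    obtain ⟨c, h₁, h₂⟩ := takesValue_trans_iff.mp H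
    obtain ⟨d, h₃, h₄⟩ := takesValue_trans_iff.mp h₂
    exact (h₁.trans h₃).trans h₄
  one_mul := by
    rintro ⟨f⟩
    refine Quotient.sound (equiv_of_takesValue fun T b a H => ?_)
    obtain ⟨c, h₁, h₂⟩ := takesValue_trans_iff.mp H
    rwa [← takesValue_refl.mp h₂]
  mul_one := by
    rintro ⟨f⟩
    refine Quotient.sound (equiv_of_takesValue fun T b a H => ?_)
    obtain ⟨c, h₁, h₂⟩ := takesValue_trans_iff.mp H
    rwa [takesValue_refl.mp h₁]
  inv_mul_cancel := by
    rintro ⟨f⟩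
    refine Quotient.sound (equiv_of_takesValue fun T b a H => ?_)
    obtain ⟨c, h₁, h₂⟩ := takesValue_trans_iff.mp H
    exact takesValue_refl.mpr (h₁.symm.unique h₂)

/-- The underlying rational map of a birational map. -/
def toRationalMap (g : Bir X) : X.left.RationalMap X.left :=
  Quotient.lift (fun f : PartialAut X => f.1.toRationalMap)
    (fun _ _ h => Scheme.PartialMap.toRationalMap_eq_iff.mpr h) g

end Bir

variable {k : Type u} [Field k]

theorem isSeparated_left (X : Over (Spec (.of k))) [IsSeparated X.hom] : X.left.IsSeparated := by
  refine ⟨?_⟩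
  rw [← Limits.terminal.comp_from X.hom]
  infer_instance

namespace Bir

variable {X : Over (Spec (.of k))} [IsReduced X.left] [IsSeparated X.hom]

/-- The representative of `g` which is defined on the largest possible open subset of `X`. -/
def partialMap (g : Bir X) : X.left.PartialMap X.left :=
  haveI := isSeparated_left X
  g.toRationalMap.toPartialMap

/-- `Dom(g)`, the largest dense open subset of `X` on which `g` is a morphism. -/
def dom (g : Bir X) : X.left.Opens := g.partialMap.domain

/-- The morphism `Dom(g) ⟶ X` given by `g`. -/
def hom (g : Bir X) : g.dom.toScheme ⟶ X.left := g.partialMap.hom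

end Bir

/-! ### Strict birational group laws -/

variable {X W : Over (Spec (.of k))}

/-- The coordinates of a morphism to `X × X × X`, indexed by `0, 1, 2`. -/
def coord (emb : W ⟶ X ⊗ X ⊗ X) : Fin 3 → (W ⟶ X) :=
  ![emb ≫ fst _ _, emb ≫ snd _ _ ≫ fst _ _, emb ≫ snd _ _ ≫ snd _ _]

/-- The projection `pr i j : W ⟶ X × X`. -/
def pr (emb : W ⟶ X ⊗ X ⊗ X) (i j : Fin 3) : W ⟶ X ⊗ X :=
  lift (coord emb i) (coord emb j)

/-- The `k`-points of an object over `k`. -/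
abbrev Pt (X : Over (Spec (.of k))) : Type u := 𝟙_ (Over (Spec (.of k))) ⟶ X

/-- The morphism `(a, id) : X ⟶ X × X` for a `k`-point `a`. -/
def leftSlice (a : Pt X) : X ⟶ X ⊗ X := lift (toUnit X ≫ a) (𝟙 X)

/-- The morphism `(id, a) : X ⟶ X × X` for a `k`-point `a`. -/
def rightSlice (a : Pt X) : X ⟶ X ⊗ X := lift (𝟙 X) (toUnit X ≫ a)

/-- The `k`-point `(a, b, c)` of `X × X × X` lies in `W`. -/
def MemLaw (emb : W ⟶ X ⊗ X ⊗ X) (a b c : Pt X) : Prop :=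
  ∃ w : Pt W, w ≫ emb = lift a (lift b c)

/-- `W`, embedded in `X × X × X` by `emb`, is a strict birational group law on `X`.
The set `U i j` is the range of `pr emb i j`. The product `a b` is defined if `(a, b) ∈ U 0 1`, and
it then is the unique `c` with `(a, b, c) ∈ W`. -/
structure IsStrictBirationalGroupLaw (emb : W ⟶ X ⊗ X ⊗ X) : Prop where
  isReduced : IsReduced W.left
  isImmersion : IsImmersion emb.left
  isOpenImmersion_pr : ∀ i j, i < j → IsOpenImmersion (pr emb i j).left
  dense_range_pr : ∀ i j, i < j → Dense (Set.range (pr emb i j).left)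
  dense_leftSlice : ∀ i j, i < j → ∀ a : Pt X,
    Dense ((leftSlice a).left ⁻¹' Set.range (pr emb i j).left)
  dense_rightSlice : ∀ i j, i < j → ∀ a : Pt X,
    Dense ((rightSlice a).left ⁻¹' Set.range (pr emb i j).left)
  /-- If `ab`, `bc`, `(ab)c` and `a(bc)` are defined then `a(bc) = (ab)c`. -/
  assoc : ∀ a b c ab bc x y : Pt X, MemLaw emb a b ab → MemLaw emb b c bc → MemLaw emb ab c x →
    MemLaw emb a bc y → y = x

section

variable {emb : W ⟶ X ⊗ X ⊗ X} (h : IsStrictBirationalGroupLaw emb)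

/-- The open subset `U i j` of `X × X`. -/
def domain {i j : Fin 3} (hij : i < j) : (X ⊗ X).left.Opens :=
  haveI := h.isOpenImmersion_pr i j hij
  (pr emb i j).left.opensRange

/-- The lift of a morphism to `X × X` with image in `U i j` to a morphism to `W`. -/
def liftLaw {T : Over (Spec (.of k))} {i j : Fin 3} (hij : i < j) (p : T ⟶ X ⊗ X)
    (hp : Set.range p.left ⊆ Set.range (pr emb i j).left) : T ⟶ W :=
  haveI := h.isOpenImmersion_pr i j hij
  Over.homMk (IsOpenImmersion.lift (pr emb i j).left p.left hp) (by
    rw [← Over.w (pr emb i j), IsOpenImmersion.lift_fac_assoc, Over.w])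

theorem liftLaw_pr {T : Over (Spec (.of k))} {i j : Fin 3} (hij : i < j) (p : T ⟶ X ⊗ X)
    (hp : Set.range p.left ⊆ Set.range (pr emb i j).left) :
    liftLaw h hij p hp ≫ pr emb i j = p := by
  have := h.isOpenImmersion_pr i j hij
  apply Over.OverMorphism.ext
  exact IsOpenImmersion.lift_fac (pr emb i j).left p.left hp

theorem hom_ext_pr (h : IsStrictBirationalGroupLaw emb) {T : Over (Spec (.of k))} {i j : Fin 3}
    (hij : i < j) {v w : T ⟶ W} (e : v ≫ pr emb i j = w ≫ pr emb i j) : v = w := by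
  have := h.isOpenImmersion_pr i j hij
  ext1
  rw [← cancel_mono (pr emb i j).left, ← Over.comp_left, e, Over.comp_left]

/-- The open subset `(a, id)⁻¹ (U 0 j)` of `X`. -/
def slice (a : Pt X) {j : Fin 3} (hj : 0 < j) : X.left.Opens :=
  (leftSlice a).left ⁻¹ᵁ domain h hj

/-- The open subset `(a, id)⁻¹ (U 0 j)` of `X`, as an object over `k`. -/
abbrev sliceOver (a : Pt X) {j : Fin 3} (hj : 0 < j) : Over (Spec (.of k)) :=
  Over.mk ((slice h a hj).ι ≫ X.hom)

/-- Its inclusion into `X`. -/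
def sliceIncl (a : Pt X) {j : Fin 3} (hj : 0 < j) : sliceOver h a hj ⟶ X :=
  Over.homMk (slice h a hj).ι rfl

theorem range_slice (a : Pt X) {j : Fin 3} (hj : 0 < j) :
    Set.range (sliceIncl h a hj ≫ leftSlice a).left ⊆ Set.range (pr emb 0 j).left := by
  rintro _ ⟨x, rfl⟩
  exact x.2

/-- The morphism `(a, id)⁻¹ (U 0 j) ⟶ W` whose coordinates `0` and `j` are `a` and the
inclusion. -/
def sliceLift (a : Pt X) {j : Fin 3} (hj : 0 < j) : sliceOver h a hj ⟶ W :=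
  liftLaw h hj (sliceIncl h a hj ≫ leftSlice a) (range_slice h a hj)

theorem sliceLift_pr (a : Pt X) {j : Fin 3} (hj : 0 < j) :
    sliceLift h a hj ≫ pr emb 0 j = sliceIncl h a hj ≫ leftSlice a :=
  liftLaw_pr _ _ _ _

theorem sliceLift_coord_zero (a : Pt X) {j : Fin 3} (hj : 0 < j) :
    sliceLift h a hj ≫ coord emb 0 = toUnit _ ≫ a := by
  have := congr($(sliceLift_pr h a hj) ≫ fst _ _)
  simpa [pr, leftSlice] using this

theorem sliceLift_coord (a : Pt X) {j : Fin 3} (hj : 0 < j) :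
    sliceLift h a hj ≫ coord emb j = sliceIncl h a hj := by
  have := congr($(sliceLift_pr h a hj) ≫ snd _ _)
  simpa [pr, leftSlice] using this

theorem sliceLift_pr' (a : Pt X) {j l : Fin 3} (hj : 0 < j) :
    sliceLift h a hj ≫ pr emb 0 l = (sliceLift h a hj ≫ coord emb l) ≫ leftSlice a := by
  simp only [pr, leftSlice, comp_lift, sliceLift_coord_zero, Category.comp_id, ← Category.assoc]
  rw [toUnit_unique ((sliceLift h a hj ≫ coord emb l) ≫ toUnit X) (toUnit _)]

theorem range_sliceLift (a : Pt X) {j l : Fin 3} (hj : 0 < j) (hl : 0 < l) :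
    Set.range (sliceLift h a hj ≫ coord emb l).left ⊆ Set.range (slice h a hl).ι := by
  rw [Scheme.Opens.range_ι]
  rintro _ ⟨x, rfl⟩
  refine ⟨(sliceLift h a hj).left x, ?_⟩
  rw [← Scheme.Hom.comp_apply, ← Scheme.Hom.comp_apply, ← Over.comp_left, ← Over.comp_left,
    sliceLift_pr']

/-- The morphism from `(a, id)⁻¹ (U 0 j)` to `(a, id)⁻¹ (U 0 l)` sending `x` to the coordinate `l`
of the point of `W` with coordinate `0` equal to `a` and coordinate `j` equal to `x`. -/
def slideHom (a : Pt X) {j l : Fin 3} (hj : 0 < j) (hl : 0 < l) :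
    (slice h a hj).toScheme ⟶ (slice h a hl).toScheme :=
  IsOpenImmersion.lift (slice h a hl).ι (sliceLift h a hj ≫ coord emb l).left
    (range_sliceLift h a hj hl)

theorem slideHom_ι (a : Pt X) {j l : Fin 3} (hj : 0 < j) (hl : 0 < l) :
    slideHom h a hj hl ≫ (slice h a hl).ι = (sliceLift h a hj ≫ coord emb l).left :=
  IsOpenImmersion.lift_fac _ _ _

theorem slideHom_over (a : Pt X) {j l : Fin 3} (hj : 0 < j) (hl : 0 < l) :
    slideHom h a hj hl ≫ (slice h a hl).ι ≫ X.hom = (slice h a hj).ι ≫ X.hom := by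
  rw [← Category.assoc, slideHom_ι, Over.w]
  rfl

theorem slideHom_slideHom (a : Pt X) {j l : Fin 3} (hj : 0 < j) (hl : 0 < l) :
    slideHom h a hj hl ≫ slideHom h a hl hj = 𝟙 _ := by
  let f : sliceOver h a hj ⟶ sliceOver h a hl :=
    Over.homMk (slideHom h a hj hl) (slideHom_over h a hj hl)
  have hf : f ≫ sliceIncl h a hl = sliceLift h a hj ≫ coord emb l := by
    ext1
    exact slideHom_ι h a hj hl
  have e : f ≫ sliceLift h a hl = sliceLift h a hj := by
    apply hom_ext_pr h hl
    rw [Category.assoc, sliceLift_pr, ← Category.assoc, hf, sliceLift_pr']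
  have e' : (f ≫ sliceLift h a hl ≫ coord emb j).left = (slice h a hj).ι := by
    rw [← Category.assoc, e, sliceLift_coord]
    rfl
  rw [← cancel_mono (slice h a hj).ι, Category.assoc, slideHom_ι, Category.id_comp]
  exact e'

theorem dense_slice (a : Pt X) {j : Fin 3} (hj : 0 < j) :
    Dense (slice h a hj : Set X.left) :=
  h.dense_leftSlice 0 j hj a

/-- Left translation by `a`: the isomorphism `x ↦ ax` from `(a, id)⁻¹ (U 0 1)` to
`(a, id)⁻¹ (U 0 2)`. -/
def leftTranslation (a : Pt X) : PartialAut X :=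
  ⟨{ source := slice h a (j := 1) (by decide)
     dense_source := dense_slice h a _
     target := slice h a (j := 2) (by decide)
     dense_target := dense_slice h a _
     iso :=
      { hom := slideHom h a _ _
        inv := slideHom h a _ _
        hom_inv_id := slideHom_slideHom h a _ _
        inv_hom_id := slideHom_slideHom h a _ _ } },
    slideHom_over h a _ _⟩

/-- The birational map `φ(a)` from `X` to itself given by left translation by `a`. -/
def phi (a : Pt X) : Bir X := Bir.mk (leftTranslation h a)

/-- The group of birational maps generated by the left translations. -/
def translationGroup : Subgroup (Bir X) := Subgroup.closure (Set.range (phi h))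

/-- The map `φ` with values in the group generated by its image. -/
def phiG (a : Pt X) : translationGroup h := ⟨phi h a, Subgroup.subset_closure ⟨a, rfl⟩⟩

/-- The chart `φ_g`, sending `a` to `g φ(a)`. -/
def chart (g : translationGroup h) (a : Pt X) : translationGroup h := g * phiG h a

end

end

end BirationalGroupLaw

open BirationalGroupLaw

/-! Everything is verified at `k`-points. Every non-empty locally closed subset of a `k`-scheme
locally of finite type contains one. Morphisms out of reduced such schemes are determined by their
values there (`hom_ext_pt`), and products of such schemes remain reduced (`isReduced_pullback`).
Conversely, a map of `k`-points that is locally given by morphisms comes from a morphism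
(`RegularAt.exists_hom`).

The law is only partially defined, but for a fixed point every product or quotient with a general
point exists, and its value is again general (`eventually_coord`). Associativity at a general third
factor gives `φ(a)φ(b) = φ(ab)` (`phi_mul`). Inserting a general `x` turns `φ(c)φ(a)φ(b)⁻¹` into
`φ(c(ax))φ(bx)⁻¹`, so every element of `G` has the form `φ(a)φ(b)⁻¹` (`exists_phi_mul_phi_inv`).

The heart is `takes_iff`: `g` is defined at `b` with value `a` if and only if `φ(a) = g φ(b)`. At
general points this is a computation. An arbitrary `b` is moved to a general point by right
multiplication with a general `x`: the identity `g(yx) = g(y)x` holds for general `y`, hence at `b`;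
and solving `zx = g(yx)` for `z` extends `g` to `b`. It follows that the charts `φ_{g₁}` and
`φ_{g₂}` overlap along the graph of `g₁⁻¹g₂` on its maximal domain, so they glue. The fibres of `(a,
b) ↦ φ(a)φ(b)⁻¹` and the isomorphisms `Dom(g) ≅ Dom(g⁻¹)` are read off from the same equivalence.

Division is a morphism on `X × X` because `φ(a)φ(b)⁻¹ = φ(x)⁻¹φ(z)` with `zb = xa`, where `x` can be
kept fixed near a given `(a, b)` (`exists_div`). Left translations permute the charts, right
translations are obtained by a similar trick, and together they carry division to the whole glued
scheme (`exists_groupScheme_div`). Separatedness then comes for free from the group structure, and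
quasi-compactness from the surjectivity of division on `X × X`. -/

namespace BirationalGroupLaw
-- `k`-points, and morphisms determined by them.
noncomputable section
variable {k : Type u} [Field k]
variable {X Y Z : Over (Spec (.of k))}

/-- The morphism of schemes underlying a `k`-point. -/
def pointHom (a : Pt X) : Spec (.of k) ⟶ X.left := a.left

/-- The point of the underlying space of `X` given by a `k`-point of `X`. -/
def pointOf (a : Pt X) : X.left :=
  pointHom a (IsLocalRing.closedPoint k)

theorem pointOf_comp (a : Pt X) (f : X ⟶ Y) : pointOf (a ≫ f) = f.left (pointOf a) :=
  Scheme.Hom.comp_apply (pointHom a) f.left _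

theorem range_left (a : Pt X) : Set.range a.left = {pointOf a} := by
  have : Subsingleton ↥((𝟙_ (Over (Spec (.of k)))).left) :=
    inferInstanceAs (Subsingleton (Spec (.of k)))
  ext x
  constructor
  · rintro ⟨y, rfl⟩
    exact congr(a.left $(Subsingleton.elim _ _))
  · rintro rfl
    exact ⟨_, rfl⟩

/-- The lift of a `k`-point along an open immersion whose range contains it. -/
theorem exists_lift {f : X ⟶ Y} [IsOpenImmersion f.left] {b : Pt Y}
    (hb : pointOf b ∈ Set.range f.left) : ∃ a : Pt X, a ≫ f = b := by
  have hr : Set.range b.left ⊆ Set.range f.left := by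
    rw [range_left]
    exact Set.singleton_subset_iff.mpr hb
  refine ⟨Over.homMk (IsOpenImmersion.lift f.left b.left hr) ?_, ?_⟩
  · rw [← Over.w f, IsOpenImmersion.lift_fac_assoc, Over.w]
  · ext1
    exact IsOpenImmersion.lift_fac _ _ _

section

variable [IsAlgClosed k] [LocallyOfFiniteType X.hom]

theorem exists_pointOf_eq {x : X.left} (hx : IsClosed {x}) : ∃ a : Pt X, pointOf a = x :=
  ⟨Over.homMk (pointOfClosedPoint X.hom x hx) (pointOfClosedPoint_comp X.hom x hx),
    pointOfClosedPoint_apply X.hom x hx _⟩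

/-- `X` is a Jacobson space, so a non-empty locally closed subset contains a closed point of `X`,
and closed points are rational because `k` is algebraically closed. -/
theorem exists_pointOf_mem {S : Set X.left} (hS : IsLocallyClosed S) (h : S.Nonempty) :
    ∃ a : Pt X, pointOf a ∈ S := by
  have : JacobsonSpace X.left := LocallyOfFiniteType.jacobsonSpace X.hom
  obtain ⟨x, hx, hx'⟩ := nonempty_inter_closedPoints h hS
  obtain ⟨a, rfl⟩ := exists_pointOf_eq hx'
  exact ⟨a, hx⟩

theorem opens_le_of_forall_pointOf {U V : X.left.Opens}
    (h : ∀ a : Pt X, pointOf a ∈ U → pointOf a ∈ V) : U ≤ V := by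
  by_contra hn
  obtain ⟨x, hx, hx'⟩ := Set.not_subset.mp hn
  obtain ⟨a, ha, ha'⟩ := exists_pointOf_mem
    (U.isOpen.isLocallyClosed.inter V.isOpen.isClosed_compl.isLocallyClosed) ⟨x, hx, hx'⟩
  exact ha' (h a ha)

theorem opens_eq_top_of_forall_pointOf {V : X.left.Opens} (h : ∀ a : Pt X, pointOf a ∈ V) :
    V = ⊤ :=
  top_le_iff.mp (opens_le_of_forall_pointOf fun a _ => h a)

/-- Morphisms from a reduced scheme locally of finite type to a separated scheme which agree on the
`k`-points of a dense open subset are equal. -/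
theorem hom_ext_of_dense [IsReduced X.left] [LocallyOfFiniteType Y.hom] [IsSeparated Y.hom]
    {f g : X ⟶ Y} {U : Set X.left} (hU : IsOpen U) (hU' : Dense U)
    (h : ∀ a : Pt X, pointOf a ∈ U → a ≫ f = a ≫ g) : f = g := by
  ext1
  have : LocallyOfFiniteType (f.left ≫ Y.hom) := by rw [Over.w]; infer_instance
  refine ext_of_apply_eq Y.hom U hU.isLocallyClosed hU' (fun x hx hx' => ?_) (by simp)
  obtain ⟨a, rfl⟩ := exists_pointOf_eq hx'
  rw [← pointOf_comp, h a hx, pointOf_comp]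

/-- Morphisms from a reduced scheme locally of finite type which agree on `k`-points are equal. -/
theorem hom_ext_pt [IsReduced X.left] [LocallyOfFiniteType Y.hom]
    {f g : X ⟶ Y} (h : ∀ a : Pt X, a ≫ f = a ≫ g) : f = g := by
  -- `Y` is not assumed separated, so `hom_ext_of_dense` can only be used over affine opens `V` of
  -- `Y`. For this, `f` and `g` must have the same inverse image of `V`. This generality is needed
  -- for the glued scheme before it is known to be separated.
  have hV (V : Y.left.Opens) : f.left ⁻¹ᵁ V = g.left ⁻¹ᵁ V := by
    have e (a : Pt X) : f.left (pointOf a) = g.left (pointOf a) := by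
      rw [← pointOf_comp, h, pointOf_comp]
    refine le_antisymm (opens_le_of_forall_pointOf fun a ha => ?_)
      (opens_le_of_forall_pointOf fun a ha => ?_)
    · change g.left _ ∈ V
      rw [← e]
      exact ha
    · change f.left _ ∈ V
      rw [e]
      exact ha
  ext1
  refine Scheme.Cover.hom_ext (Scheme.openCoverOfIsOpenCover X.left
    (fun V : Y.left.affineOpens => f.left ⁻¹ᵁ V.1) ?_) _ _ fun V => ?_
  · refine TopologicalSpace.IsOpenCover.comap ?_ f.left.base.hom
    exact iSup_affineOpens_eq_top Y.left
  · change (f.left ⁻¹ᵁ V.1).ι ≫ f.left = (f.left ⁻¹ᵁ V.1).ι ≫ g.left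
    let V' : Over (Spec (.of k)) := Over.mk (V.1.ι ≫ Y.hom)
    let U : Over (Spec (.of k)) := Over.mk ((f.left ⁻¹ᵁ V.1).ι ≫ X.hom)
    let j : U ⟶ X := Over.homMk (f.left ⁻¹ᵁ V.1).ι rfl
    let i : V' ⟶ Y := Over.homMk V.1.ι rfl
    have : IsOpenImmersion i.left := inferInstanceAs (IsOpenImmersion V.1.ι)
    have : IsAffine V'.left := V.2
    have : IsSeparated V'.hom := inferInstance
    have : LocallyOfFiniteType V'.hom := by dsimp [V']; infer_instance
    have : LocallyOfFiniteType U.hom := by dsimp [U]; infer_instance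
    have : IsReduced U.left := inferInstanceAs (IsReduced (f.left ⁻¹ᵁ V.1))
    have key (m : X ⟶ Y) (hm : f.left ⁻¹ᵁ V.1 ≤ m.left ⁻¹ᵁ V.1) :
        ∃ m' : U ⟶ V', m' ≫ i = j ≫ m := by
      have hr : Set.range (j ≫ m).left ⊆ Set.range i.left := by
        change _ ⊆ Set.range V.1.ι
        rw [Scheme.Opens.range_ι]
        rintro _ ⟨x, rfl⟩
        exact hm x.2
      refine ⟨Over.homMk (IsOpenImmersion.lift i.left (j ≫ m).left hr) ?_, ?_⟩
      · rw [← Over.w i, IsOpenImmersion.lift_fac_assoc, Over.w]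
      · ext1
        exact IsOpenImmersion.lift_fac _ _ _
    obtain ⟨f', hf⟩ := key f le_rfl
    obtain ⟨g', hg⟩ := key g (hV _).le
    have : f' = g' := hom_ext_of_dense isOpen_univ dense_univ fun a _ => by
      have : Mono i.left := inferInstance
      ext1
      rw [← cancel_mono i.left, ← Over.comp_left, ← Over.comp_left, Category.assoc, Category.assoc,
        hf, hg, ← Category.assoc, ← Category.assoc, h]
    change (j ≫ f).left = (j ≫ g).left
    rw [← hf, ← hg, this]

end
end

/-! ### Reducedness of products over an algebraically closed field. -/

noncomputable section

/-- Nullstellensatz: the residue field `A ⧸ m` is finite over `k`, hence equal to `k`. -/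
theorem exists_algHom_ker_eq (k A : Type*) [Field k] [IsAlgClosed k] [CommRing A] [Algebra k A]
    [Algebra.FiniteType k A] (m : Ideal A) [m.IsMaximal] :
    ∃ χ : A →ₐ[k] k, RingHom.ker χ = m := by
  let := Ideal.Quotient.field m
  have : Module.Finite k (A ⧸ m) := finite_of_finite_type_of_isJacobsonRing k (A ⧸ m)
  have hb : Function.Bijective (algebraMap k (A ⧸ m)) :=
    IsAlgClosed.algebraMap_bijective_of_isIntegral
  let e : k ≃ₐ[k] (A ⧸ m) := AlgEquiv.ofBijective (Algebra.ofId k _) hb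
  refine ⟨e.symm.toAlgHom.comp (Ideal.Quotient.mkₐ k m), ?_⟩
  ext x
  simp [RingHom.mem_ker, Ideal.Quotient.eq_zero_iff_mem]

-- Expand a nilpotent `z` in a `k`-basis of `B`, with coefficients in `A`. Each character `χ : A →
-- k` sends `z` to a nilpotent of the reduced ring `B`, so it kills every coefficient. The
-- coefficients then lie in all maximal ideals of `A`, and these intersect in zero because `A` is a
-- reduced Jacobson ring.
open TensorProduct in
theorem isReduced_tensorProduct (k A B : Type*) [Field k] [IsAlgClosed k] [CommRing A] [CommRing B]
    [Algebra k A] [Algebra k B] [Algebra.FiniteType k A] [IsReduced A] [IsReduced B] :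
    IsReduced (A ⊗[k] B) := by
  refine ⟨fun z hz => ?_⟩
  let b := Module.Basis.ofVectorSpace k B
  let β := Algebra.TensorProduct.basis A b
  have : IsJacobsonRing A := isJacobsonRing_of_finiteType (A := k)
  refine β.ext_elem fun i => ?_
  rw [map_zero, Finsupp.zero_apply]
  have hJ : Ideal.jacobson (⊥ : Ideal A) = ⊥ := IsJacobsonRing.out' _ Ideal.isRadical_bot
  rw [← Ideal.mem_bot, ← hJ, Ideal.jacobson, Ideal.mem_sInf]
  rintro m ⟨-, hm⟩
  obtain ⟨χ, rfl⟩ := exists_algHom_ker_eq k A m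
  let ψ : A ⊗[k] B →ₐ[k] B :=
    (Algebra.TensorProduct.lid k B).toAlgHom.comp (Algebra.TensorProduct.map χ (.id k B))
  have key (w : A ⊗[k] B) : b.repr (ψ w) i = χ (β.repr w i) := by
    induction w using TensorProduct.induction_on with
    | zero => simp
    | tmul a c => simp [ψ, β]
    | add x y hx hy => simp [hx, hy]
  rw [RingHom.mem_ker]
  refine (key z).symm.trans ?_
  rw [(hz.map ψ).eq_zero, map_zero, Finsupp.zero_apply]

/-- This makes `hom_ext_pt` and `RegularAt.exists_hom` applicable to `X × X` and to the products
which occur in the group axioms. -/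
theorem isReduced_pullback {k : Type u} [Field k] [IsAlgClosed k] {X Y : Scheme.{u}}
    (f : X ⟶ Spec (.of k)) (g : Y ⟶ Spec (.of k)) [IsReduced X] [IsReduced Y]
    [LocallyOfFiniteType f] : IsReduced (Limits.pullback f g) := by
  have key {A B : CommRingCat.{u}} (f : Spec A ⟶ Spec (.of k)) (g : Spec B ⟶ Spec (.of k))
      [IsReduced (Spec A)] [IsReduced (Spec B)] [LocallyOfFiniteType f] :
      IsReduced (Limits.pullback f g) := by
    obtain ⟨f, rfl⟩ := Spec.map_surjective f
    obtain ⟨g, rfl⟩ := Spec.map_surjective g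
    algebraize [f.hom, g.hom]
    have : Algebra.FiniteType k A := by
      exact HasRingHomProperty.Spec_iff.mp ‹LocallyOfFiniteType (Spec.map f)›
    have hA : _root_.IsReduced A := by rwa [← affine_isReduced_iff]
    have hB : _root_.IsReduced B := by rwa [← affine_isReduced_iff]
    have := isReduced_tensorProduct k A B
    exact isReduced_of_isOpenImmersion (pullbackSpecIso k A B).hom
  apply +allowSynthFailures @IsReduced.of_openCover
    (𝒰 := Scheme.Pullback.openCoverOfLeftRight X.affineCover Y.affineCover f g)
  intro ij
  have h₁ : IsReduced (X.affineCover.X ij.1) := isReduced_of_isOpenImmersion (X.affineCover.f ij.1)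
  have h₂ : IsReduced (Y.affineCover.X ij.2) := isReduced_of_isOpenImmersion (Y.affineCover.f ij.2)
  have h₃ : LocallyOfFiniteType (X.affineCover.f ij.1 ≫ f) :=
    MorphismProperty.comp_mem _ _ _ inferInstance inferInstance
  exact @key _ _ _ _ h₁ h₂ h₃

section
variable {k : Type u} [Field k] {X Y Z : Over (Spec (.of k))}

instance [LocallyOfFiniteType X.hom] [LocallyOfFiniteType Y.hom] :
    LocallyOfFiniteType (X ⊗ Y).hom := by
  dsimp
  infer_instance

instance [IsAlgClosed k] [LocallyOfFiniteType X.hom] [IsReduced X.left] [IsReduced Y.left] :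
    IsReduced (X ⊗ Y).left :=
  isReduced_pullback X.hom Y.hom

end
end

/-! ### Pullbacks of open immersions, general points and regular relations. -/

noncomputable section

section
variable {k : Type u} [Field k] {X Y Z T : Over (Spec (.of k))}

theorem isOpenImmersion_of_isPullback {P : Over (Spec (.of k))} {fst : P ⟶ X} {snd : P ⟶ Y}
    {f : X ⟶ Z} {g : Y ⟶ Z} (h : IsPullback fst snd f g) [IsOpenImmersion g.left] :
    IsOpenImmersion fst.left :=
  MorphismProperty.of_isPullback (P := @IsOpenImmersion) (h.map (Over.forget _)).flip ‹_›

theorem range_of_isPullback {P : Over (Spec (.of k))} {fst : P ⟶ X} {snd : P ⟶ Y}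
    {f : X ⟶ Z} {g : Y ⟶ Z} (h : IsPullback fst snd f g) :
    Set.range fst.left = f.left ⁻¹' Set.range g.left := by
  have h' : IsPullback fst.left snd.left f.left g.left := h.map (Over.forget _)
  rw [← Scheme.Pullback.range_fst, ← h'.isoPullback_hom_fst, Scheme.Hom.comp_base, TopCat.coe_comp,
    Set.range_comp, Set.range_eq_univ.mpr h'.isoPullback.hom.surjective, Set.image_univ]

theorem locallyOfFiniteType_of_isOpenImmersion (j : Y ⟶ X) [IsOpenImmersion j.left]
    [LocallyOfFiniteType X.hom] : LocallyOfFiniteType Y.hom := by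
  rw [← Over.w j]
  infer_instance

/-! ### Properties of general points -/

/-- The filter of the sets of `k`-points which contain the `k`-points of a dense open subset. -/
def generic (X : Over (Spec (.of k))) : Filter (Pt X) where
  sets := {S | ∃ U : X.left.Opens, Dense (U : Set X.left) ∧ ∀ a, pointOf a ∈ U → a ∈ S}
  univ_sets := ⟨⊤, dense_univ, fun _ _ => trivial⟩
  sets_of_superset := fun ⟨U, hU, h⟩ hS => ⟨U, hU, fun a ha => hS (h a ha)⟩
  inter_sets := fun ⟨U, hU, h⟩ ⟨V, hV, h'⟩ => ⟨U ⊓ V, hU.inter_of_isOpen_left hV U.2,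
    fun a ha => ⟨h a ha.1, h' a ha.2⟩⟩

theorem eventually_generic {P : Pt X → Prop} : (∀ᶠ a in generic X, P a) ↔
    ∃ U : X.left.Opens, Dense (U : Set X.left) ∧ ∀ a, pointOf a ∈ U → P a :=
  Iff.rfl

instance [IsAlgClosed k] [LocallyOfFiniteType X.hom] [Nonempty X.left] : (generic X).NeBot := by
  refine Filter.neBot_iff.mpr fun h => ?_
  obtain ⟨U, hU, h⟩ := Filter.empty_mem_iff_bot.mpr h
  obtain ⟨a, ha⟩ := exists_pointOf_mem U.2.isLocallyClosed hU.nonempty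
  exact h a ha

theorem eventually_generic_comp (j : Y ⟶ X) [IsOpenImmersion j.left] {P : Pt X → Prop}
    (h : ∀ᶠ x in generic X, P x) : ∀ᶠ y in generic Y, P (y ≫ j) := by
  obtain ⟨U, hU, h⟩ := h
  refine ⟨j.left ⁻¹ᵁ U, hU.preimage j.left.isOpenEmbedding.isOpenMap, fun a ha => h _ ?_⟩
  rw [pointOf_comp]
  exact ha

theorem eventually_generic_exists (j : Y ⟶ X) [IsOpenImmersion j.left]
    (hj : DenseRange j.left) {P : Pt Y → Prop} (h : ∀ᶠ y in generic Y, P y) :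
    ∀ᶠ x in generic X, ∃ y, y ≫ j = x ∧ P y := by
  obtain ⟨U, hU, h⟩ := h
  refine ⟨j.left ''ᵁ U, ?_, fun a ha => ?_⟩
  · rw [Scheme.Hom.coe_image]
    exact hj.dense_image j.left.continuous hU
  · obtain ⟨y, hy, e⟩ := ha
    obtain ⟨b, rfl⟩ := exists_lift (f := j) (b := a) ⟨y, e⟩
    refine ⟨b, rfl, h b ?_⟩
    rw [pointOf_comp] at e
    rwa [← j.left.injective e]

/-! ### Relations between `k`-points which are locally given by morphisms -/

/-- Near `y`, there is a morphism which sends `y` to `z` and whose graph is contained in `R`. -/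
def RegularAt (R : Pt Y → Pt Z → Prop) (y : Pt Y) (z : Pt Z) : Prop :=
  ∃ (V : Over (Spec (.of k))) (j : V ⟶ Y) (m : V ⟶ Z) (v : Pt V), IsOpenImmersion j.left ∧
    v ≫ j = y ∧ v ≫ m = z ∧ ∀ v' : Pt V, R (v' ≫ j) (v' ≫ m)

namespace RegularAt

variable {R : Pt Y → Pt Z → Prop} {S : Pt Z → Pt T → Prop} {y : Pt Y} {z : Pt Z}

theorem mono {R' : Pt Y → Pt Z → Prop} (h : RegularAt R y z) (h' : ∀ y z, R y z → R' y z) :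
    RegularAt R' y z := by
  obtain ⟨V, j, m, v, hj, h₁, h₂, h₃⟩ := h
  exact ⟨V, j, m, v, hj, h₁, h₂, fun v' => h' _ _ (h₃ v')⟩

theorem hom (m : Y ⟶ Z) (y : Pt Y) : RegularAt (fun y z => y ≫ m = z) y (y ≫ m) :=
  ⟨Y, 𝟙 Y, m, y, inferInstanceAs (IsOpenImmersion (𝟙 Y.left)), Category.comp_id _, rfl,
    fun v' => by simp⟩

theorem id (y : Pt Y) : RegularAt (fun y z => z = y) y y :=
  ⟨Y, 𝟙 Y, 𝟙 Y, y, inferInstanceAs (IsOpenImmersion (𝟙 Y.left)), Category.comp_id _,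
    Category.comp_id _, fun v' => by simp⟩

theorem const (y : Pt Y) (z : Pt Z) : RegularAt (fun _ z' => z' = z) y z :=
  ⟨Y, 𝟙 Y, toUnit Y ≫ z, y, inferInstanceAs (IsOpenImmersion (𝟙 Y.left)), Category.comp_id _,
    by rw [← Category.assoc, toUnit_unique (y ≫ toUnit Y) (𝟙 _), Category.id_comp],
    fun v' => by rw [← Category.assoc, toUnit_unique (v' ≫ toUnit Y) (𝟙 _), Category.id_comp]⟩

theorem lift_isOpenImmersion (q : Y ⟶ Z) [IsOpenImmersion q.left] (y : Pt Y) :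
    RegularAt (fun z y => y ≫ q = z) (y ≫ q) y :=
  ⟨Y, q, 𝟙 Y, y, inferInstance, rfl, Category.comp_id _, fun v' => by simp⟩

theorem comp {t : Pt T} (h : RegularAt R y z) (h' : RegularAt S z t) :
    RegularAt (fun y t => ∃ z, R y z ∧ S z t) y t := by
  obtain ⟨V, j, m, v, hj, rfl, rfl, h₃⟩ := h
  obtain ⟨V', j', m', v', hj', h₁', rfl, h₃'⟩ := h'
  have hp := IsPullback.of_hasPullback m j'
  have := isOpenImmersion_of_isPullback hp
  refine ⟨_, Limits.pullback.fst m j' ≫ j, Limits.pullback.snd m j' ≫ m',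
    hp.lift v v' h₁'.symm, ?_, hp.lift_fst_assoc .., hp.lift_snd_assoc .., fun w => ?_⟩
  · rw [Over.comp_left]
    infer_instance
  · refine ⟨(w ≫ Limits.pullback.fst m j') ≫ m, ?_, ?_⟩
    · rw [← Category.assoc]
      exact h₃ _
    · rw [Category.assoc, hp.w, ← Category.assoc, ← Category.assoc]
      exact h₃' _

theorem prodMk {S : Pt Y → Pt T → Prop} {t : Pt T} (h : RegularAt R y z) (h' : RegularAt S y t) :
    RegularAt (fun y (p : Pt (Z ⊗ T)) => R y (p ≫ fst _ _) ∧ S y (p ≫ snd _ _)) y (lift z t) := by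
  obtain ⟨V, j, m, v, hj, rfl, rfl, h₃⟩ := h
  obtain ⟨V', j', m', v', hj', h₁', rfl, h₃'⟩ := h'
  have hp := IsPullback.of_hasPullback j j'
  have := isOpenImmersion_of_isPullback hp
  refine ⟨_, Limits.pullback.fst j j' ≫ j, lift (Limits.pullback.fst j j' ≫ m)
    (Limits.pullback.snd j j' ≫ m'), hp.lift v v' h₁'.symm, ?_, hp.lift_fst_assoc .., ?_,
    fun w => ⟨?_, ?_⟩⟩
  · rw [Over.comp_left]
    infer_instance
  · rw [comp_lift, hp.lift_fst_assoc, hp.lift_snd_assoc]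
  · rw [Category.assoc, lift_fst, ← Category.assoc, ← Category.assoc]
    exact h₃ _
  · rw [Category.assoc, lift_snd, hp.w, ← Category.assoc, ← Category.assoc]
    exact h₃' _

variable [IsAlgClosed k]

/-- Two relations which are regular at `y` have the same value at `y` if they agree at general
points. -/
theorem eq_of_generic [IsReduced Y.left] [LocallyOfFiniteType Y.hom] [LocallyOfFiniteType Z.hom]
    [IsSeparated Z.hom] {R' : Pt Y → Pt Z → Prop} {z' : Pt Z} (h : RegularAt R y z)
    (h' : RegularAt R' y z')
    (H : ∀ᶠ y in generic Y, ∀ z z', R y z → R' y z' → z = z') : z = z' := by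
  -- The pair of relations provides one neighbourhood `V` on which both morphisms live. They agree
  -- on a dense open subset of `V`, hence everywhere, because `Z` is separated.
  obtain ⟨V, j, m, v, hj, rfl, h₂, h₃⟩ := h.prodMk h'
  have := locallyOfFiniteType_of_isOpenImmersion j
  have : IsReduced V.left := isReduced_of_isOpenImmersion j.left
  obtain ⟨U, hU, hU'⟩ := eventually_generic_comp j H
  have e : m ≫ fst _ _ = m ≫ snd _ _ := hom_ext_of_dense U.2 hU fun a ha => by
    simpa using hU' a ha _ _ (h₃ a).1 (h₃ a).2
  have e' := congr(v ≫ $e)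
  rw [← Category.assoc, ← Category.assoc, h₂] at e'
  simpa using e'

/-- A map between `k`-points which is locally given by morphisms is given by a morphism. -/
theorem exists_hom [IsReduced Y.left] [LocallyOfFiniteType Y.hom] [LocallyOfFiniteType Z.hom]
    {f : Pt Y → Pt Z} (h : ∀ y, RegularAt (fun y z => f y = z) y (f y)) :
    ∃ m : Y ⟶ Z, ∀ y, y ≫ m = f y := by
  choose V j m v hj h₁ h₂ h₃ using h
  let 𝒰 : Y.left.OpenCover :=
    { I₀ := Pt Y
      X := fun y => (V y).left
      f := fun y => (j y).left
      mem₀ := by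
        rw [Scheme.presieve₀_mem_precoverage_iff]
        refine ⟨fun x => ?_, fun y => hj y⟩
        have e : ⨆ y, (j y).left.opensRange = ⊤ := opens_eq_top_of_forall_pointOf fun a =>
          TopologicalSpace.Opens.mem_iSup.mpr ⟨a, pointOf (v a), by rw [← pointOf_comp, h₁]⟩
        exact TopologicalSpace.Opens.mem_iSup.mp (e.ge (Set.mem_univ x)) }
  -- On overlaps both local morphisms induce `f` on `k`-points. Since `hom_ext_pt` requires no
  -- separatedness, none is needed for `Z`.
  have hg (x y : Pt Y) : Limits.pullback.fst (j x).left (j y).left ≫ (m x).left =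
      Limits.pullback.snd (j x).left (j y).left ≫ (m y).left := by
    let P : Over (Spec (.of k)) :=
      Over.mk (Limits.pullback.fst (j x).left (j y).left ≫ (V x).hom)
    let p : P ⟶ V x := Over.homMk (Limits.pullback.fst (j x).left (j y).left) rfl
    let q : P ⟶ V y := Over.homMk (Limits.pullback.snd (j x).left (j y).left) (by
      change _ = _ ≫ (V x).hom
      rw [← Over.w (j x), ← Over.w (j y), Limits.pullback.condition_assoc])
    have e : p ≫ j x = q ≫ j y := by
      ext1
      exact Limits.pullback.condition
    have : IsOpenImmersion p.left :=
      inferInstanceAs (IsOpenImmersion (Limits.pullback.fst (j x).left (j y).left))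
    have := locallyOfFiniteType_of_isOpenImmersion (j x)
    have : IsReduced (V x).left := isReduced_of_isOpenImmersion (j x).left
    have := locallyOfFiniteType_of_isOpenImmersion p
    have : IsReduced P.left := isReduced_of_isOpenImmersion p.left
    have key : p ≫ m x = q ≫ m y := hom_ext_pt fun a => by
      rw [← Category.assoc, ← Category.assoc, ← h₃, ← h₃, Category.assoc, e, Category.assoc]
    exact congr(($key).left)
  have hover : 𝒰.glueMorphisms (fun y => (m y).left) hg ≫ Z.hom = Y.hom := by
    refine 𝒰.hom_ext _ _ fun y => ?_
    rw [Scheme.Cover.ι_glueMorphisms_assoc, Over.w]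
    exact (Over.w (j y)).symm
  refine ⟨Over.homMk _ hover, fun y => ?_⟩
  have e : j y ≫ Over.homMk _ hover = m y := by
    ext1
    exact 𝒰.ι_glueMorphisms _ hg y
  nth_rw 1 [← h₁ y]
  rw [Category.assoc, e, h₂]

end RegularAt
end
end

noncomputable section

section
variable {k : Type u} [Field k] {X : Over (Spec (.of k))}

/-! ### Values of birational maps at `k`-points -/

/-- An open subscheme, as an object over `k`. -/
abbrev opensOver (U : X.left.Opens) : Over (Spec (.of k)) := Over.mk (U.ι ≫ X.hom)

/-- The inclusion of an open subscheme. -/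
def opensIncl (U : X.left.Opens) : opensOver U ⟶ X := Over.homMk U.ι rfl

instance (U : X.left.Opens) : IsOpenImmersion (opensIncl U).left :=
  inferInstanceAs (IsOpenImmersion U.ι)

instance (U : X.left.Opens) [LocallyOfFiniteType X.hom] : LocallyOfFiniteType (opensOver U).hom :=
  locallyOfFiniteType_of_isOpenImmersion (opensIncl U)

instance (U : X.left.Opens) [IsReduced X.left] : IsReduced (opensOver U).left :=
  isReduced_of_isOpenImmersion (opensIncl U).left

theorem range_opensIncl (U : X.left.Opens) : Set.range (opensIncl U).left = U :=
  U.range_ι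

theorem denseRange_opensIncl {U : X.left.Opens} (hU : Dense (U : Set X.left)) :
    DenseRange (opensIncl U).left := by
  rwa [DenseRange, range_opensIncl]

theorem exists_lift_opensIncl {U : X.left.Opens} {b : Pt X} (hb : pointOf b ∈ U) :
    ∃ t : Pt (opensOver U), t ≫ opensIncl U = b :=
  exists_lift (by rwa [range_opensIncl])

theorem pointOf_opensIncl {U : X.left.Opens} (t : Pt (opensOver U)) :
    pointOf (t ≫ opensIncl U) ∈ U := by
  rw [pointOf_comp]
  exact (pointOf t).2

section

variable {p : X.left.PartialMap X.left}

/-- A partial map over `k`, as a morphism over `k`. -/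
def partialHom (hp : p.hom ≫ X.hom = p.domain.ι ≫ X.hom) : opensOver p.domain ⟶ X :=
  Over.homMk p.hom hp

theorem takesValue_iff_exists (hp : p.hom ≫ X.hom = p.domain.ι ≫ X.hom) {b a : Pt X} :
    TakesValue p b.left a.left ↔ ∃ t : Pt (opensOver p.domain),
      t ≫ opensIncl p.domain = b ∧ t ≫ partialHom hp = a := by
  constructor
  · rintro ⟨t, ht, ht'⟩
    refine ⟨Over.homMk t ?_, Over.OverMorphism.ext ht, Over.OverMorphism.ext ht'⟩
    change t ≫ p.domain.ι ≫ X.hom = _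
    rw [← Category.assoc, ht, Over.w]
  · rintro ⟨t, rfl, rfl⟩
    exact ⟨t.left, rfl, rfl⟩

theorem regularAt_takesValue (hp : p.hom ≫ X.hom = p.domain.ι ≫ X.hom) {b a : Pt X}
    (h : TakesValue p b.left a.left) :
    RegularAt (fun b a : Pt X => TakesValue p b.left a.left) b a := by
  obtain ⟨t, rfl, rfl⟩ := (takesValue_iff_exists hp).mp h
  exact ⟨_, opensIncl p.domain, partialHom hp, t, inferInstance, rfl, rfl,
    fun v => (takesValue_iff_exists hp).mpr ⟨v, rfl, rfl⟩⟩

theorem TakesValue.eq_pt {b a a' : Pt X} (h : TakesValue p b.left a.left)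
    (h' : TakesValue p b.left a'.left) : a = a' :=
  Over.OverMorphism.ext (h.unique h')

theorem TakesValue.pointOf_mem {b a : Pt X} (h : TakesValue p b.left a.left) :
    pointOf b ∈ p.domain := by
  obtain ⟨t, ht, -⟩ := h
  refine range_subset_of_factors t ht ?_
  rw [range_left]
  rfl

theorem exists_takesValue (hp : p.hom ≫ X.hom = p.domain.ι ≫ X.hom) {b : Pt X}
    (h : pointOf b ∈ p.domain) :
    ∃ a : Pt X, TakesValue p b.left a.left := by
  obtain ⟨t, rfl⟩ := exists_lift_opensIncl h
  exact ⟨_, (takesValue_iff_exists hp).mpr ⟨t, rfl, rfl⟩⟩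

end

theorem PartialAut.over (f : PartialAut X) :
    f.1.toPartialMap.hom ≫ X.hom = f.1.toPartialMap.domain.ι ≫ X.hom :=
  (Category.assoc _ _ _).trans f.2

instance (f : PartialAut X) : IsOpenImmersion (partialHom f.over).left :=
  inferInstanceAs (IsOpenImmersion (f.1.iso.hom ≫ f.1.target.ι))

namespace Bir

theorem exists_mk (g : Bir X) : ∃ f, mk f = g := Quotient.exists_rep g

/-- A birational map maps general points to general points. -/
theorem eventually_takesValue (f : PartialAut X) {P : Pt X → Prop} (h : ∀ᶠ y in generic X, P y) :
    ∀ᶠ x in generic X, ∃ y : Pt X, TakesValue f.1.toPartialMap x.left y.left ∧ P y := by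
  filter_upwards [eventually_generic_exists (opensIncl f.1.toPartialMap.domain)
    (denseRange_opensIncl f.1.toPartialMap.dense_domain)
    (eventually_generic_comp (partialHom f.over) h)] with x ⟨t, ht, ht'⟩
  exact ⟨_, (takesValue_iff_exists f.over).mpr ⟨t, ht, rfl⟩, ht'⟩

variable [IsReduced X.left] [IsSeparated X.hom]

theorem source_le_dom (f : PartialAut X) : f.1.source ≤ (mk f).dom :=
  f.1.toPartialMap.le_domain_toRationalMap

theorem homOfLE_source_hom (f : PartialAut X) :
    X.left.homOfLE (source_le_dom f) ≫ (mk f).hom = f.1.iso.hom ≫ f.1.target.ι :=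
  haveI := isSeparated_left X
  f.1.toPartialMap.toPartialMap_toRationalMap_restrict

theorem partialMap_over (g : Bir X) :
    g.partialMap.hom ≫ X.hom = g.partialMap.domain.ι ≫ X.hom := by
  obtain ⟨f, rfl⟩ := g.exists_mk
  change (mk f).hom ≫ _ = (mk f).dom.ι ≫ _
  have : IsDominant (X.left.homOfLE (source_le_dom f)) :=
    Opens.isDominant_homOfLE f.1.dense_source _
  have : IsReduced (mk f).dom.toScheme := inferInstance
  refine ext_of_isDominant (X.left.homOfLE (source_le_dom f)) ?_
  rw [← Category.assoc, homOfLE_source_hom, Scheme.homOfLE_ι_assoc, Category.assoc]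
  exact f.2

/-- The birational map `g` is defined at the `k`-point `b`, with value `a`. -/
def Takes (g : Bir X) (b a : Pt X) : Prop := TakesValue g.partialMap b.left a.left

theorem takes_mk {f : PartialAut X} {b a : Pt X} (h : TakesValue f.1.toPartialMap b.left a.left) :
    (mk f).Takes b a := by
  obtain ⟨t, ht, ht'⟩ := takesValue_iso.mp h
  refine ⟨t ≫ X.left.homOfLE (source_le_dom f), ?_, ?_⟩
  · exact (Category.assoc _ _ _).trans ((congrArg (t ≫ ·) (X.left.homOfLE_ι _)).trans ht)
  · exact (Category.assoc _ _ _).trans ((congrArg (t ≫ ·) (homOfLE_source_hom f)).trans ht')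

theorem Takes.unique {g : Bir X} {b a a' : Pt X} (h : g.Takes b a) (h' : g.Takes b a') : a = a' :=
  h.eq_pt h'

theorem Takes.regularAt {g : Bir X} {b a : Pt X} (h : g.Takes b a) : RegularAt g.Takes b a :=
  regularAt_takesValue g.partialMap_over h

theorem Takes.pointOf_mem {g : Bir X} {b a : Pt X} (h : g.Takes b a) : pointOf b ∈ g.dom :=
  TakesValue.pointOf_mem h

theorem exists_takes {g : Bir X} {b : Pt X} (h : pointOf b ∈ g.dom) : ∃ a, g.Takes b a :=
  exists_takesValue g.partialMap_over h

theorem eventually_takes (g : Bir X) {P : Pt X → Prop} (h : ∀ᶠ y in generic X, P y) :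
    ∀ᶠ x in generic X, ∃ y, g.Takes x y ∧ P y := by
  obtain ⟨f, rfl⟩ := g.exists_mk
  filter_upwards [eventually_takesValue f h] with x ⟨y, hy, hy'⟩
  exact ⟨y, takes_mk hy, hy'⟩

theorem eventually_takes_mul (g h : Bir X) :
    ∀ᶠ x in generic X, ∃ y z, h.Takes x y ∧ g.Takes y z ∧ (g * h).Takes x z := by
  obtain ⟨f, rfl⟩ := g.exists_mk
  obtain ⟨f', rfl⟩ := h.exists_mk
  filter_upwards [eventually_takesValue f'
    (eventually_takesValue f (.of_forall fun _ => trivial))] with x ⟨y, hy, z, hz, _⟩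
  exact ⟨y, z, takes_mk hy, takes_mk hz,
    takes_mk (f := ⟨f'.1.trans f.1, f'.2.trans f.2⟩) (hy.trans hz)⟩

variable [IsAlgClosed k] [LocallyOfFiniteType X.hom]

/-- Representatives of `g` and `h`, restricted to the intersection of their sources, agree at
general `k`-points. They therefore agree as morphisms, because `X` is reduced and separated. -/
theorem eq_of_eventually_takes {g h : Bir X}
    (H : ∀ᶠ x in generic X, ∃ y, g.Takes x y ∧ h.Takes x y) : g = h := by
  obtain ⟨f, rfl⟩ := g.exists_mk
  obtain ⟨f', rfl⟩ := h.exists_mk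
  refine Quotient.sound ?_
  have hd : Dense ((f.1.source ⊓ f'.1.source : X.left.Opens) : Set X.left) :=
    f.1.dense_source.inter_of_isOpen_left f'.1.dense_source f.1.source.2
  let V := opensOver (f.1.source ⊓ f'.1.source)
  let i : V ⟶ opensOver f.1.toPartialMap.domain :=
    Over.homMk (X.left.homOfLE inf_le_left) (X.left.homOfLE_ι_assoc _ _)
  let i' : V ⟶ opensOver f'.1.toPartialMap.domain :=
    Over.homMk (X.left.homOfLE inf_le_right) (X.left.homOfLE_ι_assoc _ _)
  have hi : i ≫ opensIncl _ = opensIncl _ :=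
    Over.OverMorphism.ext (X.left.homOfLE_ι inf_le_left)
  have hi' : i' ≫ opensIncl _ = opensIncl _ :=
    Over.OverMorphism.ext (X.left.homOfLE_ι inf_le_right)
  obtain ⟨U, hU, H⟩ := eventually_generic_comp (opensIncl (f.1.source ⊓ f'.1.source)) H
  have e : i ≫ partialHom f.over = i' ≫ partialHom f'.over := by
    refine hom_ext_of_dense U.2 hU fun a ha => ?_
    obtain ⟨y, hy, hy'⟩ := H a ha
    have h₁ := takes_mk ((takesValue_iff_exists f.over).mpr
      ⟨a ≫ i, by rw [Category.assoc, hi], rfl⟩)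
    have h₂ := takes_mk ((takesValue_iff_exists f'.over).mpr
      ⟨a ≫ i', by rw [Category.assoc, hi'], rfl⟩)
    rw [← Category.assoc, ← Category.assoc, h₁.unique hy, h₂.unique hy']
  refine equiv_iff_takesValue.mpr ⟨_, (f.1.source ⊓ f'.1.source).ι, (i ≫ partialHom f.over).left,
    inferInstance, Opens.isDominant_ι hd, ⟨i.left, congr(($hi).left), rfl⟩, ?_⟩
  rw [e]
  exact ⟨i'.left, congr(($hi').left), rfl⟩

/-- A birational map is defined at `b`, with value `a`, if near `b` it agrees at general points with
a morphism which sends `b` to `a`. -/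
theorem takes_of_regularAt {g : Bir X} {R : Pt X → Pt X → Prop} {b a : Pt X}
    (h : RegularAt R b a) (H : ∀ᶠ x in generic X, ∀ y, R x y → g.Takes x y) : g.Takes b a := by
  -- Once `g` is defined at `b`, its value there must be `a` by `RegularAt.eq_of_generic`.
  suffices hb : pointOf b ∈ g.dom by
    obtain ⟨a', ha'⟩ := exists_takes hb
    rwa [h.eq_of_generic ha'.regularAt (H.mono fun x hx y z hy hz => (hx y hy).unique hz)]
  obtain ⟨V, j, m, v, hj, rfl, rfl, hR⟩ := h
  -- The union of the graphs of the local morphism and of `g`. Generic agreement makes it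
  -- single-valued, so it defines a morphism `n` on the union `O` of the two domains.
  let S : Pt X → Pt X → Prop := fun x y => (∃ w : Pt V, w ≫ j = x ∧ w ≫ m = y) ∨ g.Takes x y
  have hV (w : Pt V) : RegularAt (fun x y => ∃ w : Pt V, w ≫ j = x ∧ w ≫ m = y) (w ≫ j) (w ≫ m) :=
    ⟨V, j, m, w, hj, rfl, rfl, fun w => ⟨w, rfl, rfl⟩⟩
  have hS {x y} (h : S x y) : RegularAt S x y := by
    obtain ⟨w, rfl, rfl⟩ | h := h
    · exact (hV w).mono fun _ _ h => .inl h
    · exact h.regularAt.mono fun _ _ h => .inr h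
  have hSu {x y z} (h : S x y) (h' : S x z) : y = z := by
    refine (hS h).eq_of_generic (hS h') (H.mono fun x hx y z hy hz => ?_)
    have key {y} (h : S x y) : g.Takes x y := by
      obtain ⟨w, rfl, rfl⟩ | h := h
      · exact hx _ (hR w)
      · exact h
    exact (key hy).unique (key hz)
  let O : X.left.Opens := j.left.opensRange ⊔ g.dom
  have hO (t : Pt (opensOver O)) : ∃ y, S (t ≫ opensIncl O) y := by
    obtain h | h := pointOf_opensIncl t
    · obtain ⟨w, hw⟩ := exists_lift (f := j) h
      exact ⟨_, .inl ⟨w, hw, rfl⟩⟩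
    · obtain ⟨y, hy⟩ := exists_takes h
      exact ⟨y, .inr hy⟩
  choose f hf using hO
  obtain ⟨n, hn⟩ := RegularAt.exists_hom (f := f) fun t =>
    ((RegularAt.hom (opensIncl O) t).comp (hS (hf t))).mono fun t y => by
      rintro ⟨_, rfl, h⟩
      exact hSu (hf t) h
  have hdom : Dense (O : Set X.left) :=
    g.partialMap.dense_domain.mono (le_sup_right (α := X.left.Opens))
  let p : X.left.PartialMap X.left := ⟨O, hdom, n.left⟩
  have hp : p.hom ≫ X.hom = p.domain.ι ≫ X.hom := Over.w n
  -- The morphism on `O` represents the same rational map as `g`, so maximality of `Dom(g)` forces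
  -- `O ≤ Dom(g)`.
  have hpg : p.toRationalMap = g.toRationalMap := by
    have := isSeparated_left X
    rw [← g.toRationalMap.toRationalMap_toPartialMap]
    refine Scheme.PartialMap.toRationalMap_eq_iff.mpr
      ⟨g.dom, g.partialMap.dense_domain, le_sup_right, le_rfl, ?_⟩
    let i : opensOver g.dom ⟶ opensOver O :=
      Over.homMk (X.left.homOfLE le_sup_right) (X.left.homOfLE_ι_assoc _ _)
    have e : i ≫ n = partialHom g.partialMap_over := hom_ext_pt fun t => by
      have ht : (t ≫ i) ≫ opensIncl O = t ≫ opensIncl g.dom := by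
        rw [Category.assoc]
        exact congrArg (t ≫ ·) (Over.OverMorphism.ext (X.left.homOfLE_ι le_sup_right))
      rw [← Category.assoc, hn]
      refine hSu (hf _) (.inr ?_)
      rw [ht]
      exact (takesValue_iff_exists g.partialMap_over).mpr ⟨t, rfl, rfl⟩
    refine congr(($e).left).trans ?_
    exact (Scheme.PartialMap.restrict_id_hom g.partialMap).symm
  have hle := p.le_domain_toRationalMap
  rw [hpg] at hle
  refine hle (le_sup_left (α := X.left.Opens) (a := j.left.opensRange) ?_)
  exact ⟨pointOf v, (pointOf_comp v j).symm⟩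

theorem Takes.mul {g h : Bir X} {x y z : Pt X} (h₁ : h.Takes x y) (h₂ : g.Takes y z) :
    (g * h).Takes x z := by
  refine takes_of_regularAt (h₁.regularAt.comp h₂.regularAt) ?_
  filter_upwards [eventually_takes_mul g h] with x ⟨y, z, hy, hz, hxz⟩
  rintro z' ⟨y', hy', hz'⟩
  obtain rfl := hy.unique hy'
  rwa [hz'.unique hz]

end Bir
end
end

noncomputable section

section
variable {k : Type u} [Field k] {X W : Over (Spec (.of k))}

/-! ### The law at `k`-points -/

theorem comp_leftSlice {T : Over (Spec (.of k))} (x : T ⟶ X) (a : Pt X) :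
    x ≫ leftSlice a = lift (toUnit T ≫ a) x := by
  rw [leftSlice, comp_lift, Category.comp_id, ← Category.assoc, toUnit_unique (x ≫ toUnit X)]

theorem comp_rightSlice {T : Over (Spec (.of k))} (x : T ⟶ X) (a : Pt X) :
    x ≫ rightSlice a = lift x (toUnit T ≫ a) := by
  rw [rightSlice, comp_lift, Category.comp_id, ← Category.assoc, toUnit_unique (x ≫ toUnit X)]

theorem toUnit_unit_comp (a : Pt X) : toUnit (𝟙_ (Over (Spec (.of k)))) ≫ a = a := by
  rw [toUnit_unique (toUnit (𝟙_ (Over (Spec (.of k))))) (𝟙 _), Category.id_comp]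

/-- The fibre of the coordinate `x` over `a` is the inverse image of the slice `(a, id)`. Conditions
(i) and (ii) on `pr i j` thereby become statements about fibres of coordinates of `W`. -/
theorem isPullback_leftSlice (x y : W ⟶ X) (a : Pt X) :
    IsPullback (Limits.pullback.fst x a) (Limits.pullback.fst x a ≫ y) (lift x y)
      (leftSlice a) := by
  have hp := IsPullback.of_hasPullback x a
  refine ⟨⟨?_⟩, ⟨Limits.PullbackCone.IsLimit.mk _ (fun s => hp.lift s.fst (toUnit _) ?_)
    (fun s => hp.lift_fst ..) (fun s => ?_) (fun s m hm _ => ?_)⟩⟩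
  · rw [comp_leftSlice, comp_lift, hp.w, toUnit_unique (Limits.pullback.snd x a)]
  · have := s.condition =≫ fst _ _
    rwa [comp_leftSlice, Category.assoc, lift_fst, lift_fst] at this
  · have := s.condition =≫ snd _ _
    rw [comp_leftSlice, Category.assoc, lift_snd, lift_snd] at this
    exact (hp.lift_fst_assoc ..).trans this
  · exact hp.hom_ext (hm.trans (hp.lift_fst ..).symm) (toUnit_unique _ _)

theorem isPullback_rightSlice (x y : W ⟶ X) (a : Pt X) :
    IsPullback (Limits.pullback.fst x a) (Limits.pullback.fst x a ≫ y) (lift y x)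
      (rightSlice a) := by
  have hp := IsPullback.of_hasPullback x a
  refine ⟨⟨?_⟩, ⟨Limits.PullbackCone.IsLimit.mk _ (fun s => hp.lift s.fst (toUnit _) ?_)
    (fun s => hp.lift_fst ..) (fun s => ?_) (fun s m hm _ => ?_)⟩⟩
  · rw [comp_rightSlice, comp_lift, hp.w, toUnit_unique (Limits.pullback.snd x a)]
  · have := s.condition =≫ snd _ _
    rwa [comp_rightSlice, Category.assoc, lift_snd, lift_snd] at this
  · have := s.condition =≫ fst _ _
    rw [comp_rightSlice, Category.assoc, lift_fst, lift_fst] at this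
    exact (hp.lift_fst_assoc ..).trans this
  · exact hp.hom_ext (hm.trans (hp.lift_fst ..).symm) (toUnit_unique _ _)

variable {emb : W ⟶ X ⊗ X ⊗ X}

theorem memLaw_iff {a b c : Pt X} : MemLaw emb a b c ↔
    ∃ w : Pt W, w ≫ coord emb 0 = a ∧ w ≫ coord emb 1 = b ∧ w ≫ coord emb 2 = c := by
  refine exists_congr fun w => ⟨fun e => ?_, ?_⟩
  · simp only [coord, Matrix.cons_val, ← Category.assoc, e]
    simp
  · rintro ⟨rfl, rfl, rfl⟩
    ext1
    · simp [coord]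
    · ext1 <;> simp [coord]

theorem openImmersion_and_dense_of_fibre (h : IsStrictBirationalGroupLaw emb) {i j : Fin 3}
    (hij : i ≠ j) (a : Pt X) :
    IsOpenImmersion (Limits.pullback.fst (coord emb i) a ≫ coord emb j).left ∧
      DenseRange (Limits.pullback.fst (coord emb i) a ≫ coord emb j).left := by
  obtain hij | hij := hij.lt_or_gt
  · have hp := (isPullback_leftSlice (coord emb i) (coord emb j) a).flip
    have : IsOpenImmersion (lift (coord emb i) (coord emb j)).left := h.isOpenImmersion_pr i j hij
    refine ⟨isOpenImmersion_of_isPullback hp, ?_⟩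
    rw [DenseRange, range_of_isPullback hp]
    exact h.dense_leftSlice i j hij a
  · have hp := (isPullback_rightSlice (coord emb i) (coord emb j) a).flip
    have : IsOpenImmersion (lift (coord emb j) (coord emb i)).left := h.isOpenImmersion_pr j i hij
    refine ⟨isOpenImmersion_of_isPullback hp, ?_⟩
    rw [DenseRange, range_of_isPullback hp]
    exact h.dense_rightSlice j i hij a

/-- The fibre of `W` over the value `a` of coordinate `i` is embedded in `X` as an open subscheme by
coordinates `j` and `l`. A general condition on coordinate `l` thus holds at general points of the
fibre, and these map onto general points `x` by coordinate `j`, whose image is dense. The four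
lemmas below are the instances in use. -/
theorem eventually_coord (h : IsStrictBirationalGroupLaw emb) {i j l : Fin 3} (hij : i ≠ j)
    (hil : i ≠ l) (a : Pt X) {P : Pt X → Prop} (hP : ∀ᶠ z in generic X, P z) :
    ∀ᶠ x in generic X, ∃ w : Pt W, w ≫ coord emb i = a ∧ w ≫ coord emb j = x ∧
      P (w ≫ coord emb l) := by
  obtain ⟨h₁, h₂⟩ := openImmersion_and_dense_of_fibre h hij a
  obtain ⟨h₃, -⟩ := openImmersion_and_dense_of_fibre h hil a
  filter_upwards [eventually_generic_exists _ h₂ (eventually_generic_comp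
    (Limits.pullback.fst (coord emb i) a ≫ coord emb l) hP)] with x ⟨v, hv, hv'⟩
  refine ⟨v ≫ Limits.pullback.fst _ _, ?_, by rwa [Category.assoc], by rwa [Category.assoc]⟩
  rw [Category.assoc, Limits.pullback.condition, ← Category.assoc,
    toUnit_unique (v ≫ _) (𝟙 _), Category.id_comp]

section generic

variable (h : IsStrictBirationalGroupLaw emb) {P : Pt X → Prop} (a : Pt X)

include h

theorem eventually_mul_right (hP : ∀ᶠ z in generic X, P z) :
    ∀ᶠ x in generic X, ∃ c, MemLaw emb a x c ∧ P c := by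
  filter_upwards [eventually_coord h (i := 0) (j := 1) (l := 2) (by decide) (by decide) a hP]
    with x ⟨w, h₁, h₂, h₃⟩
  exact ⟨_, memLaw_iff.mpr ⟨w, h₁, h₂, rfl⟩, h₃⟩

theorem eventually_inv_mul (hP : ∀ᶠ z in generic X, P z) :
    ∀ᶠ x in generic X, ∃ y, MemLaw emb a y x ∧ P y := by
  filter_upwards [eventually_coord h (i := 0) (j := 2) (l := 1) (by decide) (by decide) a hP]
    with x ⟨w, h₁, h₂, h₃⟩
  exact ⟨_, memLaw_iff.mpr ⟨w, h₁, rfl, h₂⟩, h₃⟩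

theorem eventually_mul_left (hP : ∀ᶠ z in generic X, P z) :
    ∀ᶠ x in generic X, ∃ c, MemLaw emb x a c ∧ P c := by
  filter_upwards [eventually_coord h (i := 1) (j := 0) (l := 2) (by decide) (by decide) a hP]
    with x ⟨w, h₁, h₂, h₃⟩
  exact ⟨_, memLaw_iff.mpr ⟨w, h₂, h₁, rfl⟩, h₃⟩

theorem eventually_mul_inv (hP : ∀ᶠ z in generic X, P z) :
    ∀ᶠ x in generic X, ∃ y, MemLaw emb y a x ∧ P y := by
  filter_upwards [eventually_coord h (i := 1) (j := 2) (l := 0) (by decide) (by decide) a hP]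
    with x ⟨w, h₁, h₂, h₃⟩
  exact ⟨_, memLaw_iff.mpr ⟨w, rfl, h₁, h₂⟩, h₃⟩

end generic

theorem eq_of_comp_coord (h : IsStrictBirationalGroupLaw emb) {i j : Fin 3} (hij : i < j)
    {v w : Pt W} (hi : v ≫ coord emb i = w ≫ coord emb i)
    (hj : v ≫ coord emb j = w ≫ coord emb j) : v = w :=
  hom_ext_pr h hij (by rw [pr, comp_lift, comp_lift, hi, hj])

section

variable (h : IsStrictBirationalGroupLaw emb) {a b c a' b' c' : Pt X} (hm : MemLaw emb a b c)

include h hm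

theorem memLaw_unique_mul (hm' : MemLaw emb a b c') : c = c' := by
  obtain ⟨v, rfl, rfl, rfl⟩ := memLaw_iff.mp hm
  obtain ⟨w, h₁, h₂, rfl⟩ := memLaw_iff.mp hm'
  rw [eq_of_comp_coord h (i := 0) (j := 1) (by decide) h₁ h₂]

theorem memLaw_unique_left (hm' : MemLaw emb a' b c) : a = a' := by
  obtain ⟨v, rfl, rfl, rfl⟩ := memLaw_iff.mp hm
  obtain ⟨w, rfl, h₁, h₂⟩ := memLaw_iff.mp hm'
  rw [eq_of_comp_coord h (i := 1) (j := 2) (by decide) h₁ h₂]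

variable {Y : Over (Spec (.of k))} {R S : Pt Y → Pt X → Prop} {y : Pt Y}

/-- Since `pr 0 1` is an open immersion, a pair near `(a, b)` lifts to `W`, and coordinate `2` of
the lift is a morphism. -/
theorem regularAt_mul (hR : RegularAt R y a) (hS : RegularAt S y b) :
    RegularAt (fun y z => ∃ a b, R y a ∧ S y b ∧ MemLaw emb a b z) y c := by
  obtain ⟨w, rfl, rfl, rfl⟩ := memLaw_iff.mp hm
  have := h.isOpenImmersion_pr 0 1 (by decide)
  have h₁ := hR.prodMk hS
  rw [← comp_lift] at h₁
  refine (h₁.comp ((RegularAt.lift_isOpenImmersion (pr emb 0 1) w).comp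
    (.hom (coord emb 2) w))).mono ?_
  rintro y _ ⟨_, ⟨h₁, h₂⟩, w, rfl, rfl⟩
  exact ⟨_, _, h₁, h₂, memLaw_iff.mpr ⟨w, by simp [pr], by simp [pr], rfl⟩⟩

/-- The same argument with `pr 1 2`: right division is regular wherever it is defined. -/
theorem regularAt_mul_inv (hR : RegularAt R y b) (hS : RegularAt S y c) :
    RegularAt (fun y z => ∃ b c, R y b ∧ S y c ∧ MemLaw emb z b c) y a := by
  obtain ⟨w, rfl, rfl, rfl⟩ := memLaw_iff.mp hm
  have := h.isOpenImmersion_pr 1 2 (by decide)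
  have h₁ := hR.prodMk hS
  rw [← comp_lift] at h₁
  refine (h₁.comp ((RegularAt.lift_isOpenImmersion (pr emb 1 2) w).comp
    (.hom (coord emb 0) w))).mono ?_
  rintro y _ ⟨_, ⟨h₁, h₂⟩, w, rfl, rfl⟩
  exact ⟨_, _, h₁, h₂, memLaw_iff.mpr ⟨w, rfl, by simp [pr], by simp [pr]⟩⟩

end

/-! ### Left translations and the group which they generate -/

theorem takesValue_leftTranslation (h : IsStrictBirationalGroupLaw emb) {a x c : Pt X}
    (hm : MemLaw emb a x c) :
    TakesValue (leftTranslation h a).1.toPartialMap x.left c.left := by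
  obtain ⟨w, h₀, h₁, h₂⟩ := memLaw_iff.mp hm
  have hw : w ≫ pr emb 0 1 = x ≫ leftSlice a := by
    rw [pr, comp_lift, comp_leftSlice, toUnit_unit_comp, h₀, h₁]
  have hx : pointOf x ∈ slice h a (j := 1) (by decide) := by
    change (leftSlice a).left (pointOf x) ∈ Set.range (pr emb 0 1).left
    rw [← pointOf_comp, ← hw, pointOf_comp]
    exact ⟨_, rfl⟩
  obtain ⟨t, ht⟩ := exists_lift_opensIncl hx
  have htw : t ≫ sliceLift h a (j := 1) (by decide) = w := by
    refine hom_ext_pr h (i := 0) (j := 1) (by decide) ?_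
    rw [Category.assoc, sliceLift_pr, hw, ← ht, Category.assoc]
    rfl
  refine takesValue_iso.mpr ⟨t.left, congr(($ht).left), ?_⟩
  refine (congrArg (t.left ≫ ·) (slideHom_ι h a _ _)).trans ?_
  rw [← h₂, ← htw, Category.assoc]
  rfl

section

variable [IsReduced X.left] [IsSeparated X.hom] (h : IsStrictBirationalGroupLaw emb)

theorem takes_phi {a x c : Pt X} (hm : MemLaw emb a x c) : (phi h a).Takes x c :=
  Bir.takes_mk (takesValue_leftTranslation h hm)

theorem takes_phi_inv {a x c : Pt X} (hm : MemLaw emb a x c) : (phi h a)⁻¹.Takes c x :=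
  Bir.takes_mk (f := ⟨(leftTranslation h a).1.symm, (leftTranslation h a).2.symm⟩)
    (takesValue_leftTranslation h hm).symm

variable [IsAlgClosed k] [LocallyOfFiniteType X.hom]

/-- Birational maps may be compared at general `x`, where all four products required by `h.assoc`
exist. -/
theorem phi_mul {a b c : Pt X} (hm : MemLaw emb a b c) : phi h a * phi h b = phi h c := by
  refine Bir.eq_of_eventually_takes ?_
  have true_ : ∀ᶠ x in generic X, True := .of_forall fun _ => trivial
  filter_upwards [eventually_mul_right h b (eventually_mul_right h a true_),
    eventually_mul_right h c true_] with x ⟨bx, h₁, y, h₂, _⟩ ⟨z, h₃, _⟩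
  refine ⟨y, (takes_phi h h₁).mul (takes_phi h h₂), ?_⟩
  rw [h.assoc a b x c bx z y hm h₁ h₃ h₂]
  exact takes_phi h h₃

theorem phiG_mul {a b c : Pt X} (hm : MemLaw emb a b c) : phiG h a * phiG h b = phiG h c :=
  Subtype.ext (phi_mul h hm)

variable [Nonempty X.left]

/-- For general `x` both `ax` and `bx` are defined, and they coincide. Cancelling `x` is possible
because `pr 1 2` is a monomorphism. -/
theorem phi_injective : Function.Injective (phi h) := fun a b e => by
  have true_ : ∀ᶠ x in generic X, True := .of_forall fun _ => trivial
  obtain ⟨x, ⟨c, h₁, -⟩, ⟨c', h₂, -⟩⟩ :=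
    ((eventually_mul_right h a true_).and (eventually_mul_right h b true_)).exists
  have h₃ := takes_phi h h₁
  rw [e] at h₃
  obtain rfl := h₃.unique (takes_phi h h₂)
  exact memLaw_unique_left h h₁ h₂

theorem exists_phi_mul_phi_inv {g : Bir X} (hg : g ∈ translationGroup h) :
    ∃ a b, phi h a * (phi h b)⁻¹ = g := by
  have true_ : ∀ᶠ x in generic X, True := .of_forall fun _ => trivial
  induction hg using Subgroup.closure_induction_left with
  | one =>
    obtain ⟨a, -⟩ := (eventually_generic.mpr ⟨⊤, dense_univ, fun _ _ => trivial⟩ :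
      ∀ᶠ x in generic X, True).exists
    exact ⟨a, a, mul_inv_cancel _⟩
  | mul_left g hg g' _ ih =>
    obtain ⟨c, rfl⟩ := hg
    obtain ⟨a, b, rfl⟩ := ih
    -- `φ(c)φ(a)φ(b)⁻¹ = φ(c(ax))φ(bx)⁻¹` for general `x`.
    obtain ⟨x, ⟨ax, h₁, y, h₂, -⟩, ⟨bx, h₃, -⟩⟩ := ((eventually_mul_right h a
      (eventually_mul_right h c true_)).and (eventually_mul_right h b true_)).exists
    refine ⟨y, bx, ?_⟩
    rw [← phi_mul h h₂, ← phi_mul h h₁, ← phi_mul h h₃]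
    group
  | inv_mul_cancel g hg g' _ ih =>
    obtain ⟨c, rfl⟩ := hg
    obtain ⟨a, b, rfl⟩ := ih
    -- `φ(c)⁻¹φ(a)φ(b)⁻¹ = φ(y)φ(bx)⁻¹` for general `x`, where `cy = ax`.
    obtain ⟨x, ⟨ax, h₁, y, h₂, -⟩, ⟨bx, h₃, -⟩⟩ := ((eventually_mul_right h a
      (eventually_inv_mul h c true_)).and (eventually_mul_right h b true_)).exists
    refine ⟨y, bx, ?_⟩
    rw [← phi_mul h h₃, ← inv_mul_eq_iff_eq_mul.mpr (phi_mul h h₂).symm, ← phi_mul h h₁]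
    group

/-- The generic case of `takes_iff`. With `g = φ(a)φ(b)⁻¹`, a general `x` can be written `by`, and
`g` sends it to `ay`. -/
theorem eventually_takes_phi {g : Bir X} (hg : g ∈ translationGroup h) :
    ∀ᶠ x in generic X, ∃ y, g.Takes x y ∧ phi h y = g * phi h x := by
  obtain ⟨a, b, rfl⟩ := exists_phi_mul_phi_inv h hg
  have true_ : ∀ᶠ x in generic X, True := .of_forall fun _ => trivial
  filter_upwards [eventually_inv_mul h b (eventually_mul_right h a true_)]
    with x ⟨y, h₁, z, h₂, _⟩
  refine ⟨z, (takes_phi_inv h h₁).mul (takes_phi h h₂), ?_⟩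
  rw [← phi_mul h h₂, ← phi_mul h h₁]
  group

/-- It suffices that `ax = g(bx)` for general `x`. With `x` fixed, the maps `y ↦ g(yx)` and `y ↦
g(y)x` are both regular at `b` and agree for general `y`, so they agree at `b`. -/
theorem phi_eq_of_takes {g : Bir X} (hg : g ∈ translationGroup h) {a b : Pt X}
    (hab : g.Takes b a) : phi h a = g * phi h b := by
  refine Bir.eq_of_eventually_takes ?_
  have true_ : ∀ᶠ x in generic X, True := .of_forall fun _ => trivial
  have hG := eventually_takes_phi h hg
  filter_upwards [eventually_mul_right h b (g.eventually_takes true_),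
    eventually_mul_right h a true_] with x ⟨c₁, h₁, c₃, h₃, _⟩ ⟨c₂, h₂, _⟩
  refine ⟨c₂, takes_phi h h₂, ?_⟩
  have key : c₃ = c₂ := by
    refine ((regularAt_mul h h₁ (.id b) (.const b x)).comp h₃.regularAt).eq_of_generic
      (regularAt_mul h h₂ hab.regularAt (.const b x)) ?_
    filter_upwards [hG, eventually_mul_left h x hG] with y hy ⟨w, hw, hwG⟩
    rintro z z' ⟨y', ⟨_, _, rfl, rfl, h₄⟩, h₅⟩ ⟨y'', _, h₆, rfl, h₇⟩
    obtain rfl := memLaw_unique_mul h hw h₄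
    obtain ⟨v, hv, hv'⟩ := hwG
    obtain rfl := hv.unique h₅
    obtain ⟨u, hu, hu'⟩ := hy
    obtain rfl := hu.unique h₆
    -- For general `y`, `φ(g(yx)) = g φ(y) φ(x) = φ(g(y)) φ(x) = φ(g(y)x)`.
    refine phi_injective h ?_
    rw [hv', ← phi_mul h h₇, hu', ← phi_mul h hw, mul_assoc]
  rw [← key]
  exact (takes_phi h h₁).mul h₃

/-- Fix a general `x`. Near `b`, solving `zx = g(yx)` for `z` gives a morphism in `y` which sends
`b` to `a`, because `ax = g(bx)`. At general `y` it agrees with `g`, so `g` is defined at `b`. -/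
theorem takes_of_phi_eq {g : Bir X} (hg : g ∈ translationGroup h) {a b : Pt X}
    (hab : phi h a = g * phi h b) : g.Takes b a := by
  have true_ : ∀ᶠ x in generic X, True := .of_forall fun _ => trivial
  have hG := eventually_takes_phi h hg
  obtain ⟨x, ⟨c, h₁, d, h₂, -⟩, d', h₃, -⟩ := ((eventually_mul_right h b
    (g.eventually_takes true_)).and (eventually_mul_right h a true_)).exists
  have h₄ := (takes_phi h h₁).mul h₂
  rw [← hab] at h₄
  obtain rfl := h₄.unique (takes_phi h h₃)
  refine Bir.takes_of_regularAt (regularAt_mul_inv h h₃ (.const b x)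
    ((regularAt_mul h h₁ (.id b) (.const b x)).comp h₂.regularAt)) ?_
  filter_upwards [hG, eventually_mul_left h x hG] with y ⟨u, hu, hu'⟩ ⟨w, hw, v, hv, hv'⟩
  rintro z ⟨_, z', rfl, ⟨y', ⟨_, _, rfl, rfl, h₅⟩, h₆⟩, h₇⟩
  obtain rfl := memLaw_unique_mul h hw h₅
  obtain rfl := hv.unique h₆
  have e : phi h z = phi h u := by
    rw [hu', ← mul_left_inj, phi_mul h h₇, hv', ← phi_mul h hw, mul_assoc]
  rwa [phi_injective h e]

/-- The graph of `g` on its maximal domain is described inside the group `G`. The coordinate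
changes, the fibres of division and the behaviour of `Dom(g)` under inversion all rest on this. -/
theorem takes_iff {g : Bir X} (hg : g ∈ translationGroup h) {a b : Pt X} :
    g.Takes b a ↔ phi h a = g * phi h b :=
  ⟨phi_eq_of_takes h hg, takes_of_phi_eq h hg⟩

/-- The `k`-point `a` in the chart `g₁` is the `k`-point `b` in the chart `g₂` if and only if the
birational map `g₁⁻¹ g₂` sends `b` to `a`. -/
theorem chart_eq_chart_iff {g₁ g₂ : translationGroup h} {a b : Pt X} :
    chart h g₁ a = chart h g₂ b ↔ (g₁⁻¹ * g₂).1.Takes b a := by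
  rw [takes_iff h (g₁⁻¹ * g₂).2, ← Subtype.coe_inj]
  change g₁.1 * phi h a = g₂.1 * phi h b ↔ phi h a = (g₁.1⁻¹ * g₂.1) * phi h b
  rw [mul_assoc, eq_inv_mul_iff_mul_eq]

theorem phiG_mul_phiG_inv_eq_iff {g : translationGroup h} {a b : Pt X} :
    phiG h a * (phiG h b)⁻¹ = g ↔ g.1.Takes b a := by
  rw [takes_iff h g.2, mul_inv_eq_iff_eq_mul, ← Subtype.coe_inj]
  rfl

theorem exists_phiG_mul_phiG_inv (g : translationGroup h) :
    ∃ a b, phiG h a * (phiG h b)⁻¹ = g := by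
  obtain ⟨a, b, e⟩ := exists_phi_mul_phi_inv h g.2
  exact ⟨a, b, Subtype.ext e⟩

end

end
end

noncomputable section

section
variable {k : Type u} [Field k] {X Y W : Over (Spec (.of k))}

/-! ### Gluing of charts -/

section

variable [IsAlgClosed k] [LocallyOfFiniteType Y.hom]

theorem range_subset_of_forall_pointOf {f : Y ⟶ X} {U : X.left.Opens}
    (hf : ∀ t : Pt Y, pointOf (t ≫ f) ∈ U) : Set.range f.left ⊆ Set.range (opensIncl U).left := by
  have e : f.left ⁻¹ᵁ U = ⊤ := opens_eq_top_of_forall_pointOf fun t => by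
    have := hf t
    rwa [pointOf_comp] at this
  rw [range_opensIncl]
  rintro _ ⟨y, rfl⟩
  exact e.ge (Set.mem_univ y)

/-- The factorization of a morphism through an open subscheme. -/
def liftOpens (f : Y ⟶ X) (U : X.left.Opens) (hf : ∀ t : Pt Y, pointOf (t ≫ f) ∈ U) :
    Y ⟶ opensOver U :=
  Over.homMk (IsOpenImmersion.lift (opensIncl U).left f.left
    (range_subset_of_forall_pointOf hf)) <| by
    rw [← Over.w (opensIncl U), IsOpenImmersion.lift_fac_assoc, Over.w]

theorem liftOpens_incl (f : Y ⟶ X) (U : X.left.Opens) (hf : ∀ t : Pt Y, pointOf (t ≫ f) ∈ U) :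
    liftOpens f U hf ≫ opensIncl U = f :=
  Over.OverMorphism.ext (IsOpenImmersion.lift_fac _ _ _)

end

/-- Maps `c i` from the `k`-points of `X` to a set, such that the relation `c j a = c i b` between
`a` and `b` is the graph of a morphism `b ↦ a` defined on an open subscheme of `X`. -/
structure CompatibleCharts (X : Over (Spec (.of k))) (G J : Type u) where
  /-- The charts. -/
  c : J → Pt X → G
  /-- The domains of the coordinate changes. -/
  D : J → J → X.left.Opens
  /-- The coordinate changes. -/
  m : ∀ i j, opensOver (D i j) ⟶ X
  eq_iff : ∀ i j a b, c j a = c i b ↔ ∃ t, t ≫ opensIncl (D i j) = b ∧ t ≫ m i j = a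
  injective : ∀ i, Function.Injective (c i)

namespace CompatibleCharts

variable {G J : Type u} (C : CompatibleCharts X G J) {i j l : J}

theorem eq_of_pt (t : Pt (opensOver (C.D i j))) :
    C.c j (t ≫ C.m i j) = C.c i (t ≫ opensIncl (C.D i j)) :=
  (C.eq_iff _ _ _ _).mpr ⟨t, rfl, rfl⟩

theorem pointOf_mem {a b : Pt X} (h : C.c j a = C.c i b) : pointOf b ∈ C.D i j := by
  obtain ⟨t, rfl, -⟩ := (C.eq_iff _ _ _ _).mp h
  exact pointOf_opensIncl t

variable [IsAlgClosed k] [LocallyOfFiniteType X.hom]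

/-- The coordinate change as a morphism between the open subschemes where two charts overlap. -/
def transition (i j : J) : opensOver (C.D i j) ⟶ opensOver (C.D j i) :=
  liftOpens (C.m i j) _ fun t => C.pointOf_mem (C.eq_of_pt t).symm

theorem transition_incl (i j : J) : C.transition i j ≫ opensIncl (C.D j i) = C.m i j :=
  liftOpens_incl _ _ _

/-- The intersection of three charts. -/
abbrev triple (i j l : J) : Over (Spec (.of k)) :=
  Over.mk (Limits.pullback.fst (C.D i j).ι (C.D i l).ι ≫ (C.D i j).ι ≫ X.hom)

/-- The first projection from the intersection of three charts. -/
def tripleFst (i j l : J) : C.triple i j l ⟶ opensOver (C.D i j) :=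
  Over.homMk (Limits.pullback.fst (C.D i j).ι (C.D i l).ι) rfl

/-- The second projection from the intersection of three charts. -/
def tripleSnd (i j l : J) : C.triple i j l ⟶ opensOver (C.D i l) :=
  Over.homMk (Limits.pullback.snd (C.D i j).ι (C.D i l).ι)
    (Limits.pullback.condition_assoc (f := (C.D i j).ι) (g := (C.D i l).ι) X.hom).symm

omit [IsAlgClosed k] [LocallyOfFiniteType X.hom] in
theorem triple_condition (i j l : J) : C.tripleFst i j l ≫ opensIncl (C.D i j) =
    C.tripleSnd i j l ≫ opensIncl (C.D i l) :=
  Over.OverMorphism.ext (Limits.pullback.condition (f := (C.D i j).ι) (g := (C.D i l).ι))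

instance : IsOpenImmersion (C.tripleFst i j l).left :=
  inferInstanceAs (IsOpenImmersion (Limits.pullback.fst (C.D i j).ι (C.D i l).ι))

instance : LocallyOfFiniteType (C.triple i j l).hom :=
  locallyOfFiniteType_of_isOpenImmersion (C.tripleFst i j l)

/-- The coordinate change between the charts `i` and `j` maps the intersection with the chart `l` to
the chart `l`. -/
def tripleLift (i j l : J) : C.triple i j l ⟶ opensOver (C.D j l) :=
  liftOpens (C.tripleFst i j l ≫ C.m i j) _ fun t => by
    refine C.pointOf_mem (a := t ≫ C.tripleSnd i j l ≫ C.m i l) ?_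
    rw [← Category.assoc, C.eq_of_pt, ← Category.assoc, C.eq_of_pt, Category.assoc, Category.assoc,
      triple_condition]

theorem tripleLift_incl (i j l : J) :
    C.tripleLift i j l ≫ opensIncl (C.D j l) = C.tripleFst i j l ≫ C.m i j :=
  liftOpens_incl _ _ _

/-- The coordinate change on the intersection of three charts. -/
def tripleTransition (i j l : J) : C.triple i j l ⟶ C.triple j l i :=
  Over.homMk (Limits.pullback.lift (C.tripleLift i j l).left
    (C.tripleFst i j l ≫ C.transition i j).left (by
      have e : C.tripleLift i j l ≫ opensIncl (C.D j l) =
          (C.tripleFst i j l ≫ C.transition i j) ≫ opensIncl (C.D j i) := by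
        rw [tripleLift_incl, Category.assoc, transition_incl]
      exact congr(($e).left))) (by
    change _ ≫ Limits.pullback.fst _ _ ≫ (opensOver (C.D j l)).hom = _
    rw [Limits.pullback.lift_fst_assoc, Over.w])

theorem tripleTransition_snd (i j l : J) : C.tripleTransition i j l ≫ C.tripleSnd j l i =
    C.tripleFst i j l ≫ C.transition i j :=
  Over.OverMorphism.ext (Limits.pullback.lift_snd _ _ _)

theorem tripleTransition_fst (i j l : J) : C.tripleTransition i j l ≫ C.tripleFst j l i =
    C.tripleLift i j l :=
  Over.OverMorphism.ext (Limits.pullback.lift_fst _ _ _)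

theorem c_tripleTransition (t : Pt (C.triple i j l)) :
    C.c j ((t ≫ C.tripleTransition i j l) ≫ C.tripleFst j l i ≫ opensIncl _) =
      C.c i (t ≫ C.tripleFst i j l ≫ opensIncl _) := by
  rw [← Category.assoc, Category.assoc t, tripleTransition_fst, Category.assoc, tripleLift_incl,
    ← Category.assoc, C.eq_of_pt, Category.assoc]

theorem D_self (i : J) : C.D i i = ⊤ :=
  opens_eq_top_of_forall_pointOf fun _ => C.pointOf_mem rfl

variable [IsReduced X.left]

/-- Coordinate changes preserve the element of `G` which a `k`-point represents. A round trip thus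
fixes every `k`-point, since the charts are injective. -/
theorem tripleTransition_cocycle (i j l : J) : C.tripleTransition i j l ≫
    C.tripleTransition j l i ≫ C.tripleTransition l i j = 𝟙 _ := by
  have : Mono (C.tripleFst i j l ≫ opensIncl (C.D i j)).left := by
    rw [Over.comp_left]
    infer_instance
  have : IsReduced (C.triple i j l).left :=
    isReduced_of_isOpenImmersion (C.tripleFst i j l).left
  refine hom_ext_pt fun t => ?_
  ext1
  rw [← cancel_mono (C.tripleFst i j l ≫ opensIncl (C.D i j)).left, ← Over.comp_left,
    ← Over.comp_left]
  congr 1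
  refine C.injective i ?_
  rw [Category.comp_id, ← Category.assoc t, ← Category.assoc (t ≫ _), c_tripleTransition,
    c_tripleTransition, c_tripleTransition]

theorem transition_self (i : J) : C.transition i i = 𝟙 _ := by
  refine hom_ext_pt fun t => ?_
  ext1
  rw [← cancel_mono (opensIncl (C.D i i)).left, ← Over.comp_left, ← Over.comp_left]
  congr 1
  refine C.injective i ?_
  rw [Category.comp_id, Category.assoc, transition_incl, C.eq_of_pt]

/-- The gluing datum given by compatible charts. -/
def glueData : Scheme.GlueData.{u} where
  J := J
  U _ := X.left
  V ij := (C.D ij.1 ij.2).toScheme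
  f i j := (C.D i j).ι
  f_id i := isIso_of_isOpenImmersion_of_opensRange_eq_top _ (by
    rw [Scheme.Opens.opensRange_ι]
    exact C.D_self i)
  t i j := (C.transition i j).left
  t_id i := congr(($(C.transition_self i)).left)
  t' i j l := (C.tripleTransition i j l).left
  t_fac i j l := congr(($(C.tripleTransition_snd i j l)).left)
  cocycle i j l := congr(($(C.tripleTransition_cocycle i j l)).left)
  f_open _ _ := inferInstance

/-- The scheme obtained by gluing the charts. -/
def glued : Over (Spec (.of k)) :=
  Over.mk (Y := C.glueData.glued) (Limits.Multicoequalizer.desc _ _ (fun _ => X.hom) (by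
    rintro ⟨i, j⟩
    exact (Over.w (C.transition i j)).symm))

/-- The inclusion of a chart. -/
def chartHom (i : J) : X ⟶ C.glued :=
  Over.homMk (C.glueData.ι i) (Limits.Multicoequalizer.π_desc _ _ _ _ _)

instance : IsOpenImmersion (C.chartHom i).left :=
  C.glueData.ι_isOpenImmersion i

theorem exists_mem_range_chartHom (x : C.glued.left) : ∃ i, x ∈ Set.range (C.chartHom i).left :=
  C.glueData.ι_jointly_surjective x

theorem glue_condition (i j : J) :
    C.m i j ≫ C.chartHom j = opensIncl (C.D i j) ≫ C.chartHom i := by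
  rw [← transition_incl, Category.assoc]
  exact Over.OverMorphism.ext (C.glueData.glue_condition i j)

/-- In the glued scheme the overlap `V (i, j)` is the fibre product of the charts `i` and `j`, so
two `k`-points are identified only if a coordinate change relates them. -/
theorem comp_chartHom_eq_iff {a b : Pt X} :
    a ≫ C.chartHom i = b ≫ C.chartHom j ↔ C.c i a = C.c j b := by
  constructor
  · intro e
    obtain ⟨s, hs, hs'⟩ := Limits.PullbackCone.IsLimit.lift' (C.glueData.vPullbackConeIsLimit i j)
      a.left b.left congr(($e).left)
    rw [eq_comm, C.eq_iff]
    refine ⟨Over.homMk s ?_, Over.OverMorphism.ext hs, ?_⟩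
    · exact (Category.assoc s (C.D i j).ι X.hom).symm.trans
        ((congrArg (· ≫ X.hom) hs).trans (Over.w a))
    · rw [← transition_incl]
      exact Over.OverMorphism.ext hs'
  · intro e
    obtain ⟨t, rfl, rfl⟩ := (C.eq_iff i j b a).mp e.symm
    rw [Category.assoc, Category.assoc, glue_condition]

instance : LocallyOfFiniteType C.glued.hom := by
  have : IsZariskiLocalAtSource (@LocallyOfFiniteType : MorphismProperty Scheme.{u}) :=
    HasRingHomProperty.instIsZariskiLocalAtSource (P := @LocallyOfFiniteType)
      (Q := RingHom.FiniteType)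
  refine (IsZariskiLocalAtSource.iff_of_openCover
    (P := (@LocallyOfFiniteType : MorphismProperty Scheme.{u})) C.glueData.openCover).mpr
    fun i => ?_
  have e : C.glueData.ι i ≫ C.glued.hom = X.hom := Over.w (C.chartHom i)
  exact e.symm ▸ ‹LocallyOfFiniteType X.hom›

instance : IsReduced C.glued.left := by
  apply +allowSynthFailures @IsReduced.of_openCover (𝒰 := C.glueData.openCover)
  intro i
  exact inferInstanceAs (IsReduced X.left)

theorem exists_comp_chartHom (u : Pt C.glued) : ∃ i a, a ≫ C.chartHom i = u := by
  obtain ⟨i, hi⟩ := C.exists_mem_range_chartHom (pointOf u)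
  obtain ⟨a, ha⟩ := exists_lift hi
  exact ⟨i, a, ha⟩

/-- If the charts overlap in dense open subsets then each of them is dense. -/
theorem denseRange_chartHom (hD : ∀ i j, Dense (C.D i j : Set X.left)) (i : J) :
    DenseRange (C.chartHom i).left := by
  intro x
  obtain ⟨j, x, rfl⟩ := C.exists_mem_range_chartHom x
  refine map_mem_closure (C.chartHom j).left.continuous (hD j i x) ?_
  rintro y hy
  refine ⟨(C.m j i).left ⟨y, hy⟩, ?_⟩
  have e := congr(($(C.glue_condition j i)).left ⟨y, hy⟩)
  exact (Scheme.Hom.comp_apply (C.m j i).left (C.chartHom i).left ⟨y, hy⟩).symm.trans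
    (e.trans (Scheme.Hom.comp_apply (opensIncl (C.D j i)).left (C.chartHom j).left ⟨y, hy⟩))

end CompatibleCharts

end
end

noncomputable section

section
variable {k : Type u} [Field k] {X Y Z W 𝒢 : Over (Spec (.of k))}

/-! ### Group schemes over a field -/

/-- Two points agree exactly when their quotient is the unit. The diagonal is thus a base change of
the unit section, which is a closed immersion over a field. -/
theorem isPullback_diagonal [GrpObj 𝒢] : IsPullback (lift (𝟙 𝒢) (𝟙 𝒢)) (toUnit 𝒢)
    (fst 𝒢 𝒢 * (snd 𝒢 𝒢)⁻¹) η[𝒢] := by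
  have hs {T : Over (Spec (.of k))} {s : T ⟶ 𝒢 ⊗ 𝒢} {t : T ⟶ 𝟙_ _}
      (e : s ≫ (fst 𝒢 𝒢 * (snd 𝒢 𝒢)⁻¹) = t ≫ η[𝒢]) : s ≫ fst _ _ = s ≫ snd _ _ := by
    rw [MonObj.comp_mul, GrpObj.comp_inv, toUnit_unique t (toUnit T), ← Hom.one_def] at e
    exact mul_inv_eq_one.mp e
  refine ⟨⟨?_⟩, ⟨Limits.PullbackCone.IsLimit.mk _ (fun s => s.fst ≫ fst _ _) (fun s => ?_)
    (fun s => toUnit_unique _ _) (fun s m hm _ => ?_)⟩⟩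
  · rw [MonObj.comp_mul, GrpObj.comp_inv, lift_fst, lift_snd, mul_inv_cancel, Hom.one_def]
  · ext1
    · simp
    · simpa using hs s.condition
  · rw [← hm]
    simp

/-- A group scheme over a field is separated. -/
theorem isSeparated_of_grpObj [GrpObj 𝒢] : IsSeparated 𝒢.hom := by
  refine ⟨?_⟩
  have hp := isPullback_diagonal (𝒢 := 𝒢).map (Over.forget _)
  have : IsClosedImmersion ((Over.forget (Spec (.of k))).map η[𝒢]) :=
    inferInstanceAs (IsClosedImmersion η[𝒢].left)
  exact MorphismProperty.of_isPullback (P := @IsClosedImmersion) hp.flip this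

section

variable [IsAlgClosed k] [LocallyOfFiniteType 𝒢.hom] [IsReduced 𝒢.left]

/-- A group structure on the set of `k`-points of a reduced scheme locally of finite type comes from
a structure of group scheme if division is given by a morphism. -/
theorem exists_grpObj {G : Type*} [Group G] (E : G ≃ Pt 𝒢) (d : 𝒢 ⊗ 𝒢 ⟶ 𝒢)
    (hd : ∀ g h, lift (E g) (E h) ≫ d = E (g * h⁻¹)) :
    ∃ (_ : GrpObj 𝒢) (e : G ≃* Pt 𝒢), ∀ g, e g = E g := by
  have toUnit_comp {T : Over (Spec (.of k))} (t : Pt T) (a : Pt 𝒢) :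
      t ≫ toUnit T ≫ a = a := by
    rw [← Category.assoc, toUnit_unique (t ≫ toUnit T) (𝟙 _), Category.id_comp]
  -- Inversion is `1 / g` and multiplication is `g / h⁻¹`. The axioms are then identities between
  -- morphisms out of reduced schemes, checked at `k`-points.
  let inv : 𝒢 ⟶ 𝒢 := lift (toUnit 𝒢 ≫ E 1) (𝟙 𝒢) ≫ d
  have hinv (g : G) : E g ≫ inv = E g⁻¹ := by
    rw [comp_lift_assoc, toUnit_comp, Category.comp_id, hd, one_mul]
  let mul : 𝒢 ⊗ 𝒢 ⟶ 𝒢 := lift (fst _ _) (snd _ _ ≫ inv) ≫ d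
  have hmul (g h : G) : lift (E g) (E h) ≫ mul = E (g * h) := by
    rw [comp_lift_assoc, lift_fst, lift_snd_assoc, hinv, hd, inv_inv]
  let inst : GrpObj 𝒢 :=
    { one := E 1
      mul := mul
      inv := inv
      one_mul := by
        rw [← cancel_epi (λ_ 𝒢).inv, Iso.inv_hom_id]
        refine hom_ext_pt fun t => ?_
        obtain ⟨g, rfl⟩ := E.surjective t
        have e : E g ≫ (λ_ 𝒢).inv = lift (𝟙 _) (E g) := by
          ext1
          · exact toUnit_unique _ _
          · simp
        rw [← Category.assoc, e, lift_whiskerRight_assoc, Category.id_comp, hmul, one_mul,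
          Category.comp_id]
      mul_one := by
        rw [← cancel_epi (ρ_ 𝒢).inv, Iso.inv_hom_id]
        refine hom_ext_pt fun t => ?_
        obtain ⟨g, rfl⟩ := E.surjective t
        have e : E g ≫ (ρ_ 𝒢).inv = lift (E g) (𝟙 _) := by
          ext1
          · simp
          · exact toUnit_unique _ _
        rw [← Category.assoc, e, lift_whiskerLeft_assoc, Category.id_comp, hmul, mul_one,
          Category.comp_id]
      mul_assoc := by
        refine hom_ext_pt fun t => ?_
        obtain ⟨g₁, h₁⟩ := E.surjective (t ≫ fst _ _ ≫ fst _ _)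
        obtain ⟨g₂, h₂⟩ := E.surjective (t ≫ fst _ _ ≫ snd _ _)
        obtain ⟨g₃, h₃⟩ := E.surjective (t ≫ snd _ _)
        have ht : t = lift (lift (E g₁) (E g₂)) (E g₃) := by
          rw [h₁, h₂, h₃]
          ext1
          · ext1 <;> simp
          · simp
        rw [ht, lift_whiskerRight_assoc, hmul, hmul, lift_lift_associator_hom_assoc,
          lift_whiskerLeft_assoc, hmul, hmul, mul_assoc]
      left_inv := by
        refine hom_ext_pt fun t => ?_
        obtain ⟨g, rfl⟩ := E.surjective t
        rw [comp_lift_assoc, hinv, Category.comp_id, hmul, inv_mul_cancel, toUnit_comp]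
      right_inv := by
        refine hom_ext_pt fun t => ?_
        obtain ⟨g, rfl⟩ := E.surjective t
        rw [comp_lift_assoc, hinv, Category.comp_id, hmul, mul_inv_cancel, toUnit_comp] }
  exact ⟨inst, { E with map_mul' := fun g h => (hmul g h).symm }, fun _ => rfl⟩

/-- A scheme locally of finite type is quasi-compact if all its `k`-points are in the image of a
quasi-compact scheme. -/
theorem quasiCompact_of_forall_pt [QuasiCompact Y.hom] (f : Y ⟶ X) [LocallyOfFiniteType X.hom]
    (hf : ∀ a : Pt X, ∃ b : Pt Y, b ≫ f = a) : QuasiCompact X.hom := by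
  have : CompactSpace Y.left := (quasiCompact_iff_compactSpace Y.hom).mp inferInstance
  refine (quasiCompact_iff_compactSpace (Y := Spec (.of k)) X.hom).mpr
    ⟨isCompact_of_finite_subcover fun U hU hcov => ?_⟩
  obtain ⟨t, ht⟩ := (isCompact_range f.left.continuous).elim_finite_subcover U hU
    ((Set.subset_univ _).trans hcov)
  refine ⟨t, ?_⟩
  -- A finite subcover of the image of `Y` contains every `k`-point of `X`, hence covers `X`.
  have e : (⨆ i ∈ t, ⟨U i, hU i⟩ : X.left.Opens) = ⊤ := opens_eq_top_of_forall_pointOf fun a => by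
    obtain ⟨b, rfl⟩ := hf a
    have := ht ⟨pointOf b, rfl⟩
    rw [pointOf_comp]
    simpa using this
  intro x _
  have := e.ge (Set.mem_univ x)
  simpa using this

instance [QuasiCompact X.hom] [QuasiCompact Y.hom] : QuasiCompact (X ⊗ Y).hom := by
  dsimp
  infer_instance

end

theorem opens_hom_ext {U : X.left.Opens} {f g : Y ⟶ opensOver U}
    (e : f ≫ opensIncl U = g ≫ opensIncl U) : f = g := by
  ext1
  exact (cancel_mono (opensIncl U).left).mp congr(($e).left)

/-! ### The group scheme of a birational group law -/

section

variable [IsAlgClosed k] [IsReduced X.left] [IsSeparated X.hom] [LocallyOfFiniteType X.hom]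
  [Nonempty X.left] {emb : W ⟶ X ⊗ X ⊗ X} (h : IsStrictBirationalGroupLaw emb)

theorem takes_inv_of_mem {g : Bir X} (hg : g ∈ translationGroup h) {a b : Pt X}
    (hab : g.Takes b a) : g⁻¹.Takes a b := by
  rw [takes_iff h (inv_mem hg), phi_eq_of_takes h hg hab, inv_mul_cancel_left]

/-- The morphism `Dom(g) ⟶ Dom(g⁻¹)` given by `g`. -/
def domMap {g g' : Bir X} (hg : g ∈ translationGroup h) (hg' : g⁻¹ = g') :
    opensOver g.dom ⟶ opensOver g'.dom :=
  liftOpens (partialHom g.partialMap_over) _ fun t => by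
    subst hg'
    exact (takes_inv_of_mem h hg
      ((takesValue_iff_exists g.partialMap_over).mpr ⟨t, rfl, rfl⟩)).pointOf_mem

theorem domMap_incl {g g' : Bir X} (hg : g ∈ translationGroup h) (hg' : g⁻¹ = g') :
    domMap h hg hg' ≫ opensIncl g'.dom = partialHom g.partialMap_over :=
  liftOpens_incl _ _ _

/-- The inverse of `g` enters as a variable `g'` with a proof, so that the lemma serves for both
composites without transport along `(g⁻¹)⁻¹ = g`. -/
theorem domMap_domMap {g g' : Bir X} (hg : g ∈ translationGroup h) (hg' : g⁻¹ = g')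
    (hg'' : g' ∈ translationGroup h) (hg''' : g'⁻¹ = g) :
    domMap h hg hg' ≫ domMap h hg'' hg''' = 𝟙 _ := by
  have key (t : Pt (opensOver g.dom)) :
      (t ≫ domMap h hg hg') ≫ partialHom g'.partialMap_over = t ≫ opensIncl g.dom := by
    have h₁ : g.Takes (t ≫ opensIncl g.dom) (t ≫ partialHom g.partialMap_over) :=
      (takesValue_iff_exists g.partialMap_over).mpr ⟨t, rfl, rfl⟩
    have h₂ : g'.Takes ((t ≫ domMap h hg hg') ≫ opensIncl g'.dom)
        ((t ≫ domMap h hg hg') ≫ partialHom g'.partialMap_over) :=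
      (takesValue_iff_exists g'.partialMap_over).mpr ⟨t ≫ domMap h hg hg', rfl, rfl⟩
    have h₃ : g'.Takes (t ≫ partialHom g.partialMap_over) (t ≫ opensIncl g.dom) :=
      hg' ▸ takes_inv_of_mem h hg h₁
    rw [Category.assoc, domMap_incl] at h₂
    exact h₂.unique h₃
  refine opens_hom_ext (hom_ext_pt fun t => ?_)
  rw [Category.assoc (domMap h hg hg'), domMap_incl, Category.id_comp]
  exact (Category.assoc _ _ _).symm.trans (key t)

/-- Every `g` in the translation group induces an isomorphism from `Dom(g)` to `Dom(g⁻¹)`. -/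
theorem exists_iso_dom (g : translationGroup h) :
    ∃ i : g.1.dom.toScheme ≅ (g⁻¹).1.dom.toScheme,
      i.hom ≫ (g⁻¹).1.dom.ι = g.1.hom ∧ i.inv ≫ g.1.dom.ι = (g⁻¹).1.hom := by
  have hg : (g⁻¹).1⁻¹ = g.1 := inv_inv g.1
  refine ⟨⟨(domMap h g.2 rfl).left, (domMap h (g⁻¹).2 hg).left,
    congr(($(domMap_domMap h g.2 rfl (g⁻¹).2 hg)).left),
    congr(($(domMap_domMap h (g⁻¹).2 hg g.2 rfl)).left)⟩,
    congr(($(domMap_incl h g.2 rfl)).left), congr(($(domMap_incl h (g⁻¹).2 hg)).left)⟩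

theorem chart_injective (g : translationGroup h) : Function.Injective (chart h g) := fun _ _ e =>
  phi_injective h (congrArg Subtype.val (mul_left_cancel e))

/-- The charts of the translation group are compatible. -/
def translationCharts : CompatibleCharts X (translationGroup h) (translationGroup h) where
  c := chart h
  D i j := (j⁻¹ * i).1.dom
  m i j := partialHom (j⁻¹ * i).1.partialMap_over
  eq_iff _ _ _ _ := (chart_eq_chart_iff h).trans
    (takesValue_iff_exists (Bir.partialMap_over _))
  injective := chart_injective h

/-- The group scheme obtained by gluing the charts of the translation group. -/
def groupScheme : Over (Spec (.of k)) := (translationCharts h).glued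

instance : LocallyOfFiniteType (groupScheme h).hom :=
  inferInstanceAs (LocallyOfFiniteType (translationCharts h).glued.hom)

instance : IsReduced (groupScheme h).left :=
  inferInstanceAs (IsReduced (translationCharts h).glued.left)

/-- The chart `φ_g` as a morphism. -/
def chartMap (g : translationGroup h) : X ⟶ groupScheme h := (translationCharts h).chartHom g

instance (g : translationGroup h) : IsOpenImmersion (chartMap h g).left :=
  inferInstanceAs (IsOpenImmersion ((translationCharts h).chartHom g).left)

theorem comp_chartMap_eq_iff {g₁ g₂ : translationGroup h} {a b : Pt X} :
    a ≫ chartMap h g₁ = b ≫ chartMap h g₂ ↔ chart h g₁ a = chart h g₂ b :=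
  (translationCharts h).comp_chartHom_eq_iff

theorem exists_comp_chartMap (u : Pt (groupScheme h)) : ∃ g a, a ≫ chartMap h g = u :=
  (translationCharts h).exists_comp_chartHom u

theorem denseRange_chartMap (g : translationGroup h) : DenseRange (chartMap h g).left :=
  (translationCharts h).denseRange_chartHom (fun i j => (j⁻¹ * i).1.partialMap.dense_domain) g

/-- The translation group is the group of `k`-points of the group scheme. -/
theorem exists_equiv_pt : ∃ E : translationGroup h ≃ Pt (groupScheme h),
    ∀ g a, a ≫ chartMap h g = E (chart h g a) := by
  obtain ⟨a₀, -⟩ := exists_pointOf_mem (X := X) isOpen_univ.isLocallyClosed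
    Set.univ_nonempty
  -- With `a₀` fixed, `g` is the element which `a₀` represents in the chart indexed by `g φ(a₀)⁻¹`.
  let f (g : translationGroup h) : Pt (groupScheme h) := a₀ ≫ chartMap h (g * (phiG h a₀)⁻¹)
  have hc (g : translationGroup h) : chart h (g * (phiG h a₀)⁻¹) a₀ = g :=
    inv_mul_cancel_right _ _
  have hf (g : translationGroup h) (a : Pt X) : a ≫ chartMap h g = f (chart h g a) := by
    rw [comp_chartMap_eq_iff, hc]
  refine ⟨.ofBijective f ⟨fun g g' e => ?_, fun u => ?_⟩, hf⟩
  · rw [comp_chartMap_eq_iff, hc, hc] at e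
    exact e
  · obtain ⟨g, a, rfl⟩ := exists_comp_chartMap h u
    exact ⟨chart h g a, (hf g a).symm⟩

end
end
end

noncomputable section

section
variable {k : Type u} [Field k] [IsAlgClosed k] {X W : Over (Spec (.of k))}
  [IsReduced X.left] [IsSeparated X.hom] [LocallyOfFiniteType X.hom]
  [Nonempty X.left] {emb : W ⟶ X ⊗ X ⊗ X} (h : IsStrictBirationalGroupLaw emb)

/-! ### Morphisms to the group scheme -/

omit [IsAlgClosed k] [IsReduced X.left] [IsSeparated X.hom] [LocallyOfFiniteType X.hom]
  [Nonempty X.left] in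
theorem chart_mul (g g' : translationGroup h) (a : Pt X) :
    chart h (g * g') a = g * chart h g' a :=
  mul_assoc _ _ _

-- The auxiliary `x` exists even where `a` and `b` cannot be divided within `X`: it moves `a` to a
-- point `y = xa` which can be divided by `b`, and the factor `φ(x)⁻¹` is absorbed in the choice of
-- chart.
omit [Nonempty X.left] in
theorem phiG_mul_phiG_inv_eq {a b x y z : Pt X} (h₁ : MemLaw emb x a y) (h₂ : MemLaw emb z b y) :
    phiG h a * (phiG h b)⁻¹ = chart h (phiG h x)⁻¹ z := by
  rw [chart, mul_inv_eq_iff_eq_mul, mul_assoc, phiG_mul h h₂, ← phiG_mul h h₁, inv_mul_cancel_left]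

omit [Nonempty X.left] in
theorem phiG_mul_phiG_eq {a c x y z : Pt X} (h₁ : MemLaw emb x a y) (h₂ : MemLaw emb y c z) :
    phiG h a * phiG h c = chart h (phiG h x)⁻¹ z := by
  rw [chart, ← phiG_mul h h₂, ← phiG_mul h h₁, mul_assoc, inv_mul_cancel_left]

variable {E : translationGroup h ≃ Pt (groupScheme h)}
  (hE : ∀ g a, a ≫ chartMap h g = E (chart h g a))

include hE

/-- Left multiplication by `g` carries the chart `i` to the chart `g * i` and is the identity in
coordinates. -/
theorem exists_leftTranslation (g : translationGroup h) :
    ∃ l : groupScheme h ⟶ groupScheme h, ∀ x, E x ≫ l = E (g * x) := by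
  obtain ⟨l, hl⟩ := RegularAt.exists_hom (f := fun u => E (g * E.symm u)) fun u => by
    obtain ⟨i, a, rfl⟩ := exists_comp_chartMap h u
    have key (b : Pt X) : b ≫ chartMap h (g * i) = E (g * E.symm (b ≫ chartMap h i)) := by
      rw [hE, hE, Equiv.symm_apply_apply, chart_mul]
    have hr := (RegularAt.lift_isOpenImmersion (chartMap h i) a).comp
      (RegularAt.hom (chartMap h (g * i)) a)
    rw [key] at hr
    exact hr.mono fun y z ⟨b, e, e'⟩ => by rw [← e, ← e', key]
  exact ⟨l, fun x => by rw [hl, Equiv.symm_apply_apply]⟩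

/-- Near a given pair, a single general `x` can be used: `(a, b) ↦ z` with `zb = xa` is regular
there, and the chart indexed by `φ(x)⁻¹` turns `z` into the quotient. -/
theorem exists_div : ∃ d : X ⊗ X ⟶ groupScheme h,
    ∀ a b, lift a b ≫ d = E (phiG h a * (phiG h b)⁻¹) := by
  obtain ⟨d, hd⟩ := RegularAt.exists_hom
      (f := fun p : Pt (X ⊗ X) => E (phiG h (p ≫ fst _ _) * (phiG h (p ≫ snd _ _))⁻¹)) fun p => by
    obtain ⟨x, y, h₁, z, h₂, -⟩ := (eventually_mul_left h (p ≫ fst _ _)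
      (eventually_mul_inv h (p ≫ snd _ _) (.of_forall fun _ => trivial))).exists
    have hr := (regularAt_mul_inv h h₂ (.hom (snd X X) p)
      (regularAt_mul h h₁ (.const p x) (.hom (fst X X) p))).comp
      (.hom (chartMap h (phiG h x)⁻¹) z)
    rw [hE, ← phiG_mul_phiG_inv_eq h h₁ h₂] at hr
    refine hr.mono ?_
    rintro q _ ⟨z, ⟨_, y, rfl, ⟨_, _, rfl, rfl, h₁⟩, h₂⟩, rfl⟩
    rw [hE, phiG_mul_phiG_inv_eq h h₁ h₂]
  exact ⟨d, fun a b => by rw [hd, lift_fst, lift_snd]⟩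

theorem exists_mul_phiG (c : Pt X) : ∃ r : X ⟶ groupScheme h,
    ∀ a, a ≫ r = E (phiG h a * phiG h c) := by
  refine RegularAt.exists_hom (f := fun a => E (phiG h a * phiG h c)) fun a => ?_
  obtain ⟨x, y, h₁, z, h₂, -⟩ := (eventually_mul_left h a
    (eventually_mul_left h c (.of_forall fun _ => trivial))).exists
  have hy := regularAt_mul h h₁ (.const a x) (.id a)
  have hz := regularAt_mul h h₂ hy (.const a c)
  have hr := hz.comp (.hom (chartMap h (phiG h x)⁻¹) z)
  rw [hE, ← phiG_mul_phiG_eq h h₁ h₂] at hr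
  exact hr.mono fun _ _ ⟨_, ⟨_, _, ⟨_, _, e₁, e₂, h₁'⟩, e₃, h₂'⟩, e₄⟩ => by
    rw [e₁, e₂] at h₁'
    rw [e₃] at h₂'
    rw [← e₄, hE, phiG_mul_phiG_eq h h₁' h₂']

/-- Since `(i φ(a)) g = i (φ(a) g)`, right multiplication on the chart `i` is the given morphism
followed by left translation by `i`. -/
theorem exists_rightTranslation_of_chart {g : translationGroup h} {r : X ⟶ groupScheme h}
    (hr : ∀ a, a ≫ r = E (phiG h a * g)) :
    ∃ r' : groupScheme h ⟶ groupScheme h, ∀ x, E x ≫ r' = E (x * g) := by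
  obtain ⟨r', hr'⟩ := RegularAt.exists_hom (f := fun u => E (E.symm u * g)) fun u => by
    obtain ⟨i, a, rfl⟩ := exists_comp_chartMap h u
    obtain ⟨l, hl⟩ := exists_leftTranslation h hE i
    have key (b : Pt X) : b ≫ r ≫ l = E (E.symm (b ≫ chartMap h i) * g) := by
      rw [← Category.assoc, hr, hl, hE, Equiv.symm_apply_apply, chart, mul_assoc]
    have hr := (RegularAt.lift_isOpenImmersion (chartMap h i) a).comp (.hom (r ≫ l) a)
    rw [key] at hr
    exact hr.mono fun y z ⟨b, e, e'⟩ => by rw [← e, ← e', key]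
  exact ⟨r', fun x => by rw [hr', Equiv.symm_apply_apply]⟩

/-- Write `g = φ(c)φ(b)⁻¹`. Multiplication by `φ(c)` comes from `exists_mul_phiG`, and by `φ(b)⁻¹`
from division on the slice `(id, b)`. -/
theorem exists_rightTranslation (g : translationGroup h) :
    ∃ r : groupScheme h ⟶ groupScheme h, ∀ x, E x ≫ r = E (x * g) := by
  obtain ⟨c, b, rfl⟩ := exists_phiG_mul_phiG_inv h g
  obtain ⟨r₁, h₁⟩ := exists_mul_phiG h hE c
  obtain ⟨r₁, h₁⟩ := exists_rightTranslation_of_chart h hE h₁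
  obtain ⟨d, hd⟩ := exists_div h hE
  obtain ⟨r₂, h₂⟩ := exists_rightTranslation_of_chart h hE (g := (phiG h b)⁻¹)
    (r := rightSlice b ≫ d) fun a => by
      rw [← Category.assoc, comp_rightSlice, toUnit_unit_comp, hd]
  exact ⟨r₁ ≫ r₂, fun x => by rw [← Category.assoc, h₁, h₂, mul_assoc]⟩

theorem exists_groupScheme_div : ∃ d : groupScheme h ⊗ groupScheme h ⟶ groupScheme h,
    ∀ x y, lift (E x) (E y) ≫ d = E (x * y⁻¹) := by
  obtain ⟨d₀, hd₀⟩ := exists_div h hE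
  obtain ⟨d, hd⟩ := RegularAt.exists_hom (f := fun p : Pt (groupScheme h ⊗ groupScheme h) =>
      E (E.symm (p ≫ fst _ _) * (E.symm (p ≫ snd _ _))⁻¹)) fun p => by
    obtain ⟨i, a, ha⟩ := exists_comp_chartMap h (p ≫ fst _ _)
    obtain ⟨j, b, hb⟩ := exists_comp_chartMap h (p ≫ snd _ _)
    obtain ⟨l, hl⟩ := exists_leftTranslation h hE i
    obtain ⟨r, hr⟩ := exists_rightTranslation h hE j⁻¹
    -- `(i φ(a)) (j φ(b))⁻¹ = i (φ(a) φ(b)⁻¹) j⁻¹`: division on the charts `i` and `j` is division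
    -- on `X × X` followed by a left and a right translation.
    have key (a b : Pt X) : lift a b ≫ d₀ ≫ l ≫ r =
        E (E.symm (a ≫ chartMap h i) * (E.symm (b ≫ chartMap h j))⁻¹) := by
      rw [← Category.assoc, ← Category.assoc, hd₀, hl, hr, hE, hE, Equiv.symm_apply_apply,
        Equiv.symm_apply_apply, chart, chart, mul_inv_rev, mul_assoc, mul_assoc, mul_assoc]
    have h₁ := (RegularAt.hom (fst _ _) p)
    have h₂ := (RegularAt.hom (snd _ _) p)
    rw [← ha] at h₁
    rw [← hb] at h₂
    have h₃ := ((h₁.comp (.lift_isOpenImmersion (chartMap h i) a)).prodMk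
      (h₂.comp (.lift_isOpenImmersion (chartMap h j) b))).comp (.hom (d₀ ≫ l ≫ r) (lift a b))
    rw [key] at h₃
    rw [← ha, ← hb]
    refine h₃.mono ?_
    rintro p _ ⟨q, ⟨⟨_, rfl, e₁⟩, ⟨_, rfl, e₂⟩⟩, rfl⟩
    rw [← e₁, ← e₂, ← key, lift_comp_fst_snd]
  exact ⟨d, fun x y => by
    rw [hd, lift_fst, lift_snd, Equiv.symm_apply_apply, Equiv.symm_apply_apply]⟩

omit hE

/-- The group scheme of a strict birational group law. -/
theorem exists_groupScheme : ∃ (_ : GrpObj (groupScheme h))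
    (e : translationGroup h ≃* Pt (groupScheme h)),
    (∀ g a, a ≫ chartMap h g = e (chart h g a)) ∧
    (coord emb 0 ≫ chartMap h 1) * (coord emb 1 ≫ chartMap h 1) = coord emb 2 ≫ chartMap h 1 ∧
    (QuasiCompact X.hom → QuasiCompact (groupScheme h).hom) := by
  obtain ⟨E, hE⟩ := exists_equiv_pt h
  obtain ⟨d, hd⟩ := exists_groupScheme_div h hE
  obtain ⟨inst, e, he⟩ := exists_grpObj E d hd
  have hE' (g) (a) : a ≫ chartMap h g = e (chart h g a) := (hE g a).trans (he _).symm
  refine ⟨inst, e, hE', ?_, fun _ => ?_⟩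
  · have := h.isReduced
    have := h.isOpenImmersion_pr 0 1 (by decide)
    have := locallyOfFiniteType_of_isOpenImmersion (pr emb 0 1)
    refine hom_ext_pt fun w => ?_
    have hw := phiG_mul h (memLaw_iff.mpr ⟨w, rfl, rfl, rfl⟩)
    rw [MonObj.comp_mul, ← Category.assoc, ← Category.assoc, ← Category.assoc, hE', hE', hE',
      ← map_mul, chart, chart, chart, one_mul, one_mul, one_mul, hw]
  · obtain ⟨d, hd⟩ := exists_div h hE
    refine quasiCompact_of_forall_pt d fun u => ?_
    obtain ⟨g, rfl⟩ := E.surjective u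
    obtain ⟨a, b, rfl⟩ := exists_phiG_mul_phiG_inv h g
    exact ⟨lift a b, hd a b⟩

end
end
end BirationalGroupLaw

theorem theorem2p11 {k : Type u} [Field k] [IsAlgClosed k]
    (X : Over (Spec (.of k))) [Nonempty X.left] [IsReduced X.left] [IsSeparated X.hom]
    [LocallyOfFiniteType X.hom]
    (W : Over (Spec (.of k))) (emb : W ⟶ X ⊗ X ⊗ X) (h : IsStrictBirationalGroupLaw emb) :
    -- the charts `φ_g` are compatible
    (∀ g₁ g₂ : translationGroup h, ∃ p : X.left.PartialMap X.left,
      p.hom ≫ X.hom = p.domain.ι ≫ X.hom ∧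
      ∀ a b : Pt X, chart h g₁ a = chart h g₂ b ↔ TakesValue p b.left a.left) ∧
    -- they make `G` a reduced and separated group scheme, locally of finite type over `k`
    (∃ (𝒢 : Over (Spec (.of k))) (_ : GrpObj 𝒢) (e : translationGroup h ≃* Pt 𝒢)
      (Φ : translationGroup h → (X ⟶ 𝒢)),
      (∀ g a, a ≫ Φ g = e (chart h g a)) ∧
      (∀ g, IsOpenImmersion (Φ g).left) ∧
      (∀ g, DenseRange (Φ g).left) ∧
      (∀ x : 𝒢.left, ∃ g, x ∈ Set.range (Φ g).left) ∧
      IsReduced 𝒢.left ∧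
      LocallyOfFiniteType 𝒢.hom ∧
      IsSeparated 𝒢.hom ∧
      -- the group law of `G` extends the birational group law on `X`
      (coord emb 0 ≫ Φ 1) * (coord emb 1 ≫ Φ 1) = coord emb 2 ≫ Φ 1 ∧
      -- if `X` is of finite type, so is `G`
      (QuasiCompact X.hom → QuasiCompact 𝒢.hom)) ∧
    -- the product in the abstract group `G` extends the birational group law
    (∀ a b c : Pt X, MemLaw emb a b c → phiG h a * phiG h b = phiG h c) ∧
    -- the map `(a, b) ↦ φ(a) φ(b)⁻¹` is surjective, and its fibres
    (∀ g : translationGroup h, ∃ a b : Pt X, phiG h a * (phiG h b)⁻¹ = g) ∧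
    (∀ (g : translationGroup h) (a b : Pt X),
      phiG h a * (phiG h b)⁻¹ = g ↔ TakesValue g.1.partialMap b.left a.left) ∧
    -- every `g` in `G` induces an isomorphism from `Dom(g)` to `Dom(g⁻¹)`
    (∀ g : translationGroup h, ∃ i : g.1.dom.toScheme ≅ (g⁻¹).1.dom.toScheme,
      i.hom ≫ (g⁻¹).1.dom.ι = g.1.hom ∧ i.inv ≫ g.1.dom.ι = (g⁻¹).1.hom) := by
  obtain ⟨inst, e, he, hmul, hqc⟩ := exists_groupScheme h
  refine ⟨fun g₁ g₂ => ⟨(g₁⁻¹ * g₂).1.partialMap, Bir.partialMap_over _,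
      fun _ _ => chart_eq_chart_iff h⟩,
    ⟨groupScheme h, inst, e, chartMap h, he, inferInstance, denseRange_chartMap h,
      (translationCharts h).exists_mem_range_chartHom, inferInstance, inferInstance,
      isSeparated_of_grpObj, hmul, hqc⟩,
    fun _ _ _ hm => phiG_mul h hm, exists_phiG_mul_phiG_inv h,
    fun _ _ _ => phiG_mul_phiG_inv_eq_iff h, exists_iso_dom h⟩
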